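/- Let $n\ge 1$, $N=2n-1$, and let $(q,p)=(q_1,\dots,q_N,p_1,\dots,p_N)$ be coordinates on $\mathbb R^{2N}$, with $q_0=q_{N+1}=0$. Let $\Psi:\mathbb R^{2N}\to\mathbb R^N_{>0}$ be the Volterra map $u_i=e^{p_i+\frac12(q_{i+1}-q_{i-1})}$, $1\le i\le N$; put $u_k=0$ for $k\notin\{1,\dots,N\}$. Let $h_1=\sum_{i=1}^N u_i$, let $J_2$ be the canonical Poisson tensor, $\{q_i,p_j\}=\delta_{ij}$, $\{q_i,q_j\}=\{p_i,p_j\}=0$, and let $J_3$ be the skew-symmetric tensor with \[ \begin{aligned} &\{q_i,q_j\}=u_j\ (i<j),\qquad \{q_1,p_1\}=u_1+\tfrac12u_2,\qquad \{q_i,p_i\}=\tfrac12u_i+\tfrac12u_{i+1}\ (i\ge2),\\ &\{q_i,p_{i+1}\}=\tfrac12u_{i+2},\qquad \{q_i,p_j\}=-\tfrac12u_{j-1}+\tfrac12u_{j+1}\ (j\ge i+2),\\ &\{q_2,p_1\}=u_2,\qquad \{q_i,p_{i-1}\}=\tfrac12u_i\ (i\ge3),\qquad \{q_i,p_1\}=\tfrac12u_i\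 (i\ge3),\\ &\{p_1,p_2\}=\tfrac12u_1+\tfrac14u_2-\tfrac14u_3,\qquad \{p_i,p_{i+1}\}=\tfrac14u_i+\tfrac14u_{i+1}\ (i\ge2),\\ &\{p_1,p_3\}=\tfrac12u_2-\tfrac14u_4,\qquad \{p_i,p_{i+2}\}=\tfrac14u_{i+1}\ (i\ge2),\qquad \{p_1,p_j\}=\tfrac14u_{j-1}-\tfrac14u_{j+1}\ (j\ge4), \end{aligned} \] and all other brackets of coordinates (up to skew-symmetry) zero. Tensors are identified with matrices acting on gradients. Let $\mathcal R=J_3J_2^{-1}$, $J_j=\mathcal R^{j-2}J_2$ for $j\ge2$, $\chi_j=\mathcal R^{j-1}J_2\nabla h_1$ for $j\ge1$, $X_0=\sum_{i=1}^N\partial/\partial p_i$ and $X_i=\mathcal R^iX_0$ for $i\ge0$. A vector field $Z$ is called a master symmetry of $\dot x=V(x)$ if $[[Z,V],V]=0$ and $[Z,V]\ne0$ (not identically zero). Then \[ L_{X_0}J_2=0,\qquad L_{X_0}J_3=J_3,\qquad X_0(h_1)=h_1 . \] The $J_j$ ($j\ge2$) are Poisson tensors, the $X_i$ ($i\ge0$)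 are smooth, and there are smooth functions $h_j$ ($j\ge1$) on $\mathbb R^{2N}$, starting with the given $h_1$, such that $\nabla h_j=(\mathcal R^{*})^{j-1}\nabla h_1$ and $J_2\nabla h_j=\chi_j$ for all $j\ge1$; the $h_j$ are pairwise in involution with respect to every $J_k$, $k\ge2$; the flows $\chi_j$ commute pairwise; each $X_i$ ($i\ge0$) is a master symmetry of each flow $\dot x=\chi_j(x)$ ($j\ge1$); and \[ X_i(h_j)=(i+j)h_{i+j}\ (i\ge0,\ j\ge1),\qquad L_{X_i}J_j=(j-i-2)J_{i+j}\ (i\ge0,\ j\ge2),\qquad [X_i,X_j]=(j-i)X_{i+j}\ (i,j\ge0). \] All of this projects through $\Psi$ to the KM-system $\dot u_i=u_i(u_{i+1}-u_{i-1})$ on the positive orthant $\mathbb R^N_{>0}$. Namely, let $L$ be the symmetric $(N+1)\times(N+1)$ matrix with diagonal entries $u_{k-1}+u_k$, $1\le k\le N+1$ (with $u_0=u_{N+1}=0$), entries $\sqrt{u_ku_{k+1}}$ in positions $(k,k+2)$ and $(k+2,k)$, and zeros elsewhere, and let $H_j=\frac1j\operatorname{Tr}L^j$. Then $H_j\circ\Psi=2h_j$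 for $j\ge1$, and there are smooth vector fields $Y_i$ ($i\ge0$) and smooth tensors $\pi_j$ ($j\ge2$) on $\mathbb R^N_{>0}$ such that $X_i$ is $\Psi$-related to $Y_i$, $\Psi$ maps $J_j$ to $\pi_j$, and the following hold. (0) $Y_0=\sum_i u_i\,\partial/\partial u_i$; $Y_1=\sum_i\big((i+1)u_iu_{i+1}+u_i^2+(2-i)u_{i-1}u_i\big)\partial/\partial u_i$; $\pi_2$ is the bracket $\{u_i,u_{i+1}\}=u_iu_{i+1}$; $\pi_3$ is the bracket $\{u_i,u_{i+1}\}=u_iu_{i+1}(u_i+u_{i+1})$, $\{u_i,u_{i+2}\}=u_iu_{i+1}u_{i+2}$ (all other brackets zero up to skew-symmetry). If $n\ge2$, each $Y_i$ ($i\ge0$) is a master symmetry of each flow $\dot u=\pi_2\nabla H_j$ ($j\ge1$). (i) Every $\pi_j$, $j\ge2$, is a Poisson tensor. (ii) The functions $H_i$, $i\ge1$, are pairwise in involution with respect to every $\pi_j$, $j\ge2$. (iii) $Y_i(H_j)=(i+j)H_{i+j}$ for $i\ge0$, $j\ge1$. (iv) $L_{Y_i}\pi_j=(j-i-2)\pi_{i+j}$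 for $i\ge0$, $j\ge2$. (v) $[Y_i,Y_j]=(j-i)Y_{i+j}$ for $i,j\ge0$. (vi) $\pi_j\nabla H_i=\pi_{j-1}\nabla H_{i+1}$ for $i\ge1$, $j\ge3$. -/

import Mathlib

open scoped ContDiff

namespace KM

/-! ### Tensor calculus on coordinate spaces -/

section Calculus

variable {ι : Type*} [Fintype ι] [DecidableEq ι]

/-- The gradient (column of first partial derivatives) of a function. -/
noncomputable def grad (f : (ι → ℝ) → ℝ) (x : ι → ℝ) : ι → ℝ :=
  fun a => fderiv ℝ f x (Pi.single a 1)

/-- The action `X(f)` of a vector field on a function. -/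
noncomputable def deriv (X : (ι → ℝ) → ι → ℝ) (f : (ι → ℝ) → ℝ) (x : ι → ℝ) : ℝ :=
  fderiv ℝ f x (X x)

/-- The Lie derivative of a contravariant 2-tensor:
`(L_X J)^{ab} = X^c ∂_c J^{ab} - (∂_c X^a) J^{cb} - (∂_c X^b) J^{ac}`. -/
noncomputable def lieDeriv (X : (ι → ℝ) → ι → ℝ) (J : (ι → ℝ) → Matrix ι ι ℝ) (x : ι → ℝ) :
    Matrix ι ι ℝ :=
  Matrix.of fun a b =>
    fderiv ℝ (fun y => J y a b) x (X x)
      - ∑ c, grad (fun y => X y a) x c * J x c b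
      - ∑ c, grad (fun y => X y b) x c * J x a c

/-- The bracket `{f, g} = ∑ J^{ab} ∂_a f ∂_b g` of a contravariant 2-tensor. -/
noncomputable def bracket (J : (ι → ℝ) → Matrix ι ι ℝ) (f g : (ι → ℝ) → ℝ) (x : ι → ℝ) : ℝ :=
  ∑ a, ∑ b, J x a b * grad f x a * grad g x b

/-- `J` is a (smooth) Poisson tensor on the open set `U`. -/
def IsPoissonOn (U : Set (ι → ℝ)) (J : (ι → ℝ) → Matrix ι ι ℝ) : Prop :=
  (∀ a b, ContDiffOn ℝ ∞ (fun x => J x a b) U) ∧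
  (∀ x ∈ U, ∀ a b, J x b a = -J x a b) ∧
  (∀ f g k : (ι → ℝ) → ℝ, ContDiffOn ℝ ∞ f U → ContDiffOn ℝ ∞ g U → ContDiffOn ℝ ∞ k U →
    ∀ x ∈ U, bracket J f (bracket J g k) x + bracket J g (bracket J k f) x
      + bracket J k (bracket J f g) x = 0)

/-- `Z` is a master symmetry of `ẋ = V(x)` on the open set `U`: it is a generator of degree one,
`[[Z, V], V] = 0`, but not of degree zero, `[Z, V] ≠ 0`. -/
def IsMasterSymmetryOn (U : Set (ι → ℝ)) (Z V : (ι → ℝ) → ι → ℝ) : Prop :=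
  (∀ x ∈ U, VectorField.lieBracket ℝ (VectorField.lieBracket ℝ Z V) V x = 0) ∧
  (∃ x ∈ U, VectorField.lieBracket ℝ Z V x ≠ 0)

end Calculus

/-- The coordinate `v_k`, `1 ≤ k ≤ N`, of `v` in one-based numbering, with `v_k = 0` otherwise. -/
noncomputable def coord {N : ℕ} (v : Fin N → ℝ) (k : ℕ) : ℝ :=
  if h : 1 ≤ k ∧ k ≤ N then v ⟨k - 1, by omega⟩ else 0

/-! ### The symplectic side -/

/-- The phase space `ℝ^{2N}`: `Sum.inl` indexes the `q_i`, `Sum.inr` the `p_i`. -/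
abbrev Phase (N : ℕ) : Type := (Fin N ⊕ Fin N) → ℝ

variable {N : ℕ}

/-- The coordinate `q_k`, with `q_0 = q_{N+1} = 0`. -/
noncomputable def q (x : Phase N) (k : ℕ) : ℝ := coord (fun i => x (Sum.inl i)) k

/-- The coordinate `p_k`. -/
noncomputable def p (x : Phase N) (k : ℕ) : ℝ := coord (fun i => x (Sum.inr i)) k

/-- The Volterra map `u_i = exp (p_i + (q_{i+1} - q_{i-1}) / 2)`. -/
noncomputable def volterraMap (N : ℕ) (x : Phase N) : Fin N → ℝ :=
  fun i => Real.exp (p x (i + 1) + (1 / 2) * (q x (i + 2) - q x i))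

/-- The function `u_k` on phase space, with `u_0 = u_{N+1} = 0`. -/
noncomputable def u (x : Phase N) (k : ℕ) : ℝ := coord (volterraMap N x) k

/-- The Hamiltonian `h₁ = ∑ u_i`. -/
noncomputable def h₁ (N : ℕ) (x : Phase N) : ℝ := ∑ i, volterraMap N x i

/-- The canonical symplectic bracket `{q_i, p_j} = δ_{ij}`. -/
def J₂ (N : ℕ) : Phase N → Matrix (Fin N ⊕ Fin N) (Fin N ⊕ Fin N) ℝ :=
  fun _ => Matrix.fromBlocks 0 1 (-1) 0

/-- The brackets `{q_i, q_j}` of `J₃` (one-based indices). -/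
noncomputable def qqBracket (x : Phase N) (i j : ℕ) : ℝ :=
  if i < j then u x j else if j < i then -u x i else 0

/-- The brackets `{q_i, p_j}` of `J₃` (one-based indices). -/
noncomputable def qpBracket (x : Phase N) (i j : ℕ) : ℝ :=
  if i = 1 ∧ j = 1 then u x 1 + (1 / 2) * u x 2
  else if i = j then (1 / 2) * u x i + (1 / 2) * u x (i + 1)
  else if j = i + 1 then (1 / 2) * u x (i + 2)
  else if i + 2 ≤ j then -(1 / 2) * u x (j - 1) + (1 / 2) * u x (j + 1)
  else if i = 2 ∧ j = 1 then u x 2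
  else if i = j + 1 then (1 / 2) * u x i
  else if j = 1 then (1 / 2) * u x i
  else 0

/-- The brackets `{p_i, p_j}` of `J₃` for `i < j` (one-based indices). -/
noncomputable def ppUpper (x : Phase N) (i j : ℕ) : ℝ :=
  if i = 1 ∧ j = 2 then (1 / 2) * u x 1 + (1 / 4) * u x 2 - (1 / 4) * u x 3
  else if j = i + 1 then (1 / 4) * u x i + (1 / 4) * u x (i + 1)
  else if i = 1 ∧ j = 3 then (1 / 2) * u x 2 - (1 / 4) * u x 4
  else if j = i + 2 then (1 / 4) * u x (i + 1)
  else if i = 1 then -(1 / 4) * u x (j + 1) + (1 / 4) * u x (j - 1)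
  else 0

/-- The brackets `{p_i, p_j}` of `J₃` (one-based indices). -/
noncomputable def ppBracket (x : Phase N) (i j : ℕ) : ℝ :=
  if i < j then ppUpper x i j else if j < i then -ppUpper x j i else 0

/-- The lift `J₃` of the cubic bracket. -/
noncomputable def J₃ (N : ℕ) (x : Phase N) : Matrix (Fin N ⊕ Fin N) (Fin N ⊕ Fin N) ℝ :=
  Matrix.fromBlocks
    (Matrix.of fun i j : Fin N => qqBracket x (i + 1) (j + 1))
    (Matrix.of fun i j : Fin N => qpBracket x (i + 1) (j + 1))
    (Matrix.of fun i j : Fin N => -qpBracket x (j + 1) (i + 1))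
    (Matrix.of fun i j : Fin N => ppBracket x (i + 1) (j + 1))

/-- The recursion operator `R = J₃ J₂⁻¹`. -/
noncomputable def R (N : ℕ) (x : Phase N) : Matrix (Fin N ⊕ Fin N) (Fin N ⊕ Fin N) ℝ :=
  J₃ N x * (J₂ N x)⁻¹

/-- The higher tensors `J_j = R^{j-2} J₂`, meaningful for `j ≥ 2`. -/
noncomputable def J (N : ℕ) (j : ℕ) (x : Phase N) : Matrix (Fin N ⊕ Fin N) (Fin N ⊕ Fin N) ℝ :=
  R N x ^ (j - 2) * J₂ N x

/-- The conformal symmetry `X₀ = ∑ ∂/∂p_i`. -/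
def X₀ (N : ℕ) : Phase N → Phase N := fun _ => Sum.elim 0 1

/-- The vector fields `X_i = R^i X₀`. -/
noncomputable def X (N : ℕ) (i : ℕ) (x : Phase N) : Phase N := (R N x ^ i).mulVec (X₀ N x)

/-- The flows `χ_j = R^{j-1} χ_1`, `χ_1 = J₂ ∇h₁`, meaningful for `j ≥ 1`. -/
noncomputable def flow (N : ℕ) (j : ℕ) (x : Phase N) : Phase N :=
  (R N x ^ (j - 1)).mulVec ((J₂ N x).mulVec (grad (h₁ N) x))

theorem J₂_mul_inv (x : Phase N) : J₂ N x * (J₂ N x)⁻¹ = 1 := by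
  have h : J₂ N x * -J₂ N x = 1 := by
    simp [J₂, Matrix.fromBlocks_multiply, Matrix.fromBlocks_neg]
  rw [Matrix.inv_eq_right_inv h, h]

theorem J_two (x : Phase N) : J N 2 x = J₂ N x := by simp [J]

theorem J_three (x : Phase N) : J N 3 x = J₃ N x := by
  have h : (J₂ N x)⁻¹ * J₂ N x = 1 := mul_eq_one_comm.mp (J₂_mul_inv x)
  simp [J, R, Matrix.mul_assoc, h]

/-! ### The KM-system in the variables `u_1, …, u_N` -/

/-- The open positive orthant, the domain of the KM-system and the image of the Volterra map. -/
def orthant (N : ℕ) : Set (Fin N → ℝ) := {w | ∀ i, 0 < w i}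

/-- The Lax matrix, of size `N + 1`: diagonal entries `u_1, u_1 + u_2, …, u_{N-1} + u_N, u_N`, and
`√(u_k u_{k+1})` in positions `(k, k+2)` and `(k+2, k)`. -/
noncomputable def lax (w : Fin N → ℝ) : Matrix (Fin (N + 1)) (Fin (N + 1)) ℝ :=
  Matrix.of fun a b =>
    if a = b then coord w a + coord w (a + 1)
    else if (b : ℕ) = a + 2 then √(coord w (a + 1) * coord w (a + 2))
    else if (a : ℕ) = b + 2 then √(coord w (b + 1) * coord w (b + 2))
    else 0

/-- `H_j = (1 / j) Tr L^j`. -/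
noncomputable def H (j : ℕ) (w : Fin N → ℝ) : ℝ := (1 / (j : ℝ)) * (lax w ^ j).trace

/-- The quadratic bracket `{u_i, u_{i+1}} = u_i u_{i+1}`. -/
noncomputable def π₂ (w : Fin N → ℝ) : Matrix (Fin N) (Fin N) ℝ :=
  Matrix.of fun i j =>
    if (j : ℕ) = i + 1 then w i * w j else if (i : ℕ) = j + 1 then -(w i * w j) else 0

/-- The cubic bracket `{u_i, u_{i+1}} = u_i u_{i+1} (u_i + u_{i+1})`,
`{u_i, u_{i+2}} = u_i u_{i+1} u_{i+2}`. -/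
noncomputable def π₃ (w : Fin N → ℝ) : Matrix (Fin N) (Fin N) ℝ :=
  Matrix.of fun i j =>
    if (j : ℕ) = i + 1 then w i * w j * (w i + w j)
    else if (i : ℕ) = j + 1 then -(w i * w j * (w i + w j))
    else if (j : ℕ) = i + 2 then w i * coord w (i + 2) * w j
    else if (i : ℕ) = j + 2 then -(w j * coord w (j + 2) * w i)
    else 0

/-- The Euler vector field `Y₀ = ∑ u_i ∂/∂u_i`. -/
def Y₀ (w : Fin N → ℝ) : Fin N → ℝ := w

/-- The vector field `Y₁ = ∑ U_i ∂/∂u_i`,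
`U_i = (i+1) u_i u_{i+1} + u_i² + (2-i) u_{i-1} u_i` (one-based index, `u_0 = u_{N+1} = 0`). -/
noncomputable def Y₁ (w : Fin N → ℝ) : Fin N → ℝ := fun a =>
  let i : ℕ := a + 1
  ((i : ℝ) + 1) * coord w i * coord w (i + 1) + coord w i ^ 2
    + (2 - (i : ℝ)) * coord w (i - 1) * coord w i

end KM

/-! The long table of `J₃` hides a simple object. There are constant vectors b_0, …, b_N on phase
space with J₃ = ∑ u_k b_{k-1} ∧ b_k. With σ the canonical symplectic form, σ(b_k, b_m) = -1 for all
k < m ≤ N, and log u_{k+1} = σ(b_k, ·) - σ(b_{k+1}, ·). So the recursion operator is `chainOp`, and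
everything about it follows from these pairings.

Three facts drive the hierarchy. The Nijenhuis torsion of R vanishes (`torsion_chainOp`), because it
is a double sum over pairs of links that cancels by antisymmetry. The 2-form σ(·, R·) is closed
(`dform_chainOp`). The constant field X₀ raises each log u_k at unit rate, so the derivative of R
along X₀ is R (`fderiv_chainOp_euler`). The first two pass to powers of R (`torsion_pow_pow`,
`dform_pow`). The Jacobi identity for R^m J₂, the formula for L_{X_i} J_j and that for [X_i, X_j]
are then linear combinations of torsion, closedness and the Euler relation, evaluated on constant
fields (`jacobi`, `lie_bivector`, `lieBracket_X`).

The Hamiltonians come from the Lax matrix. On the orthant L = A², where A is the Jacobi matrix with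
zero diagonal and off-diagonal entries √u_k, so h_j = Tr A^{2j} / (2j). Since dh_j(b_m) =
-(A^{2j})_{mm}, the Lenard relation dh_{j+1} = R* dh_j becomes a telescoping identity between
entries of consecutive powers of A (`sum_jacobiMatrix_lenard`). Involution and the master symmetry
relations on phase space follow formally.

Finally R and the differential of Ψ depend on x only through u, and Ψ maps onto the orthant with a
smooth section. So fields and tensors descend, and each identity upstairs yields its image
downstairs. -/

/-! ### Nijenhuis operators compatible with a constant symplectic form -/

namespace Nijenhuis

variable {E : Type*} [NormedAddCommGroup E] [NormedSpace ℝ E]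

/-- The concomitant of two fields of endomorphisms, evaluated on constant vector fields.
For `A = B` it is the Nijenhuis torsion. -/
noncomputable def torsion (A B : E → E →L[ℝ] E) (z x y : E) : E :=
  fderiv ℝ B z (A z x) y - fderiv ℝ A z (B z y) x + B z (fderiv ℝ A z y x)
    - A z (fderiv ℝ B z x y)

theorem fderiv_mul_apply {A B : E → E →L[ℝ] E} (hA : Differentiable ℝ A)
    (hB : Differentiable ℝ B) (z v x : E) :
    fderiv ℝ (fun z => A z * B z) z v x = A z (fderiv ℝ B z v x) + fderiv ℝ A z v (B z x) := by
  rw [fderiv_fun_mul' (hA z) (hB z)]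
  simp

theorem torsion_swap (A B : E → E →L[ℝ] E) (z x y : E) :
    torsion A B z x y = -torsion B A z y x := by
  simp only [torsion]; abel

/-- The concomitant obeys a Leibniz rule in its second slot. Commutation of `A` and `B` is needed
only to exchange them in front of the derivative of `C`; no commutation with `C` is involved. -/
theorem torsion_mul {A B C : E → E →L[ℝ] E} (hB : Differentiable ℝ B) (hC : Differentiable ℝ C)
    (z x y : E) (hAB : A z * B z = B z * A z) :
    torsion A (fun z => B z * C z) z x y = torsion A B z x (C z y) + B z (torsion A C z x y) := by
  have h : ∀ w, A z (B z w) = B z (A z w) := fun w => congr($hAB w)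
  simp only [torsion, fderiv_mul_apply hB hC, map_add, map_sub, mul_apply_eq_comp, h]
  abel

theorem torsion_pow_right {A R : E → E →L[ℝ] E} (hR : Differentiable ℝ R)
    (hAR : ∀ z, A z * R z = R z * A z) (h : ∀ z x y, torsion A R z x y = 0) (j : ℕ) (z x y : E) :
    torsion A (fun z => R z ^ j) z x y = 0 := by
  induction j generalizing x y with
  | zero => simp [torsion]
  | succ j ih =>
    simp only [pow_succ']
    rw [torsion_mul hR (hR.fun_pow j) z x y (hAR z), h, ih, map_zero, add_zero]

/-- Powers are raised in the right slot only; the antisymmetry `torsion_swap` moves the first power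
to the left before the second is raised. -/
theorem torsion_pow_pow {R : E → E →L[ℝ] E} (hR : Differentiable ℝ R)
    (h : ∀ z x y, torsion R R z x y = 0) (i j : ℕ) (z x y : E) :
    torsion (fun z => R z ^ i) (fun z => R z ^ j) z x y = 0 := by
  refine torsion_pow_right hR (fun z => (Commute.pow_self (R z) i).eq) (fun z x y => ?_) j z x y
  rw [torsion_swap, torsion_pow_right hR (fun _ => rfl) h, neg_zero]

/-! ### Closedness of the 2-forms of symmetric operators, and its consequences -/

variable (σ : E →L[ℝ] E →L[ℝ] ℝ)

/-- The differential of the 2-form `(x, y) ↦ σ x (A y)`, evaluated on constant vector fields. -/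
noncomputable def dform (A : E → E →L[ℝ] E) (z x y w : E) : ℝ :=
  σ w (fderiv ℝ A z x y) + σ x (fderiv ℝ A z y w) + σ y (fderiv ℝ A z w x)

variable {σ}

theorem fderiv_symm {A : E → E →L[ℝ] E} (hA : Differentiable ℝ A)
    (hs : ∀ z x y, σ (A z x) y = σ x (A z y)) (z v x y : E) :
    σ (fderiv ℝ A z v x) y = σ x (fderiv ℝ A z v y) := by
  have h1 : HasFDerivAt (fun z => σ (A z x) y)
      ((σ.flip y).comp (((ContinuousLinearMap.apply ℝ E x)).comp (fderiv ℝ A z))) z :=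
    (σ.flip y).hasFDerivAt.comp z
      (((ContinuousLinearMap.apply ℝ E x)).hasFDerivAt.comp z (hA z).hasFDerivAt)
  have h2 : HasFDerivAt (fun z => σ x (A z y))
      ((σ x).comp (((ContinuousLinearMap.apply ℝ E y)).comp (fderiv ℝ A z))) z :=
    (σ x).hasFDerivAt.comp z
      (((ContinuousLinearMap.apply ℝ E y)).hasFDerivAt.comp z (hA z).hasFDerivAt)
  simp only [hs] at h1
  exact congr($(h1.unique h2) v)

theorem pow_symm {R : E →L[ℝ] E} (hs : ∀ x y, σ (R x) y = σ x (R y)) (i : ℕ) (x y : E) :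
    σ ((R ^ i) x) y = σ x ((R ^ i) y) := by
  induction i generalizing x y with
  | zero => simp
  | succ i ih =>
    have h1 : (R ^ (i + 1)) x = (R ^ i) (R x) := by rw [pow_succ]; rfl
    have h2 : (R ^ (i + 1)) y = R ((R ^ i) y) := by rw [pow_succ']; rfl
    rw [h1, h2, ih, hs]

/-- Closedness is inherited by a product of commuting symmetric operators with vanishing
concomitant. This is what makes every power of a Nijenhuis operator compatible with the symplectic
form. -/
theorem dform_mul {A B : E → E →L[ℝ] E} (hσ : ∀ x y, σ x y = -σ y x)
    (hA : Differentiable ℝ A) (hB : Differentiable ℝ B)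
    (hsA : ∀ z x y, σ (A z x) y = σ x (A z y)) (hsB : ∀ z x y, σ (B z x) y = σ x (B z y))
    (hc : ∀ z, A z * B z = B z * A z) (hAB : ∀ z x y, torsion A B z x y = 0)
    (dA : ∀ z x y w, dform σ A z x y w = 0) (dB : ∀ z x y w, dform σ B z x y w = 0)
    (z x y w : E) : dform σ (fun z => A z * B z) z x y w = 0 := by
  -- Symmetry of the product rests on A B = B A, so the derivative of that identity is an ingredient
  -- alongside the two closedness relations and the concomitant.
  have hcomm : fderiv ℝ (fun z => A z * B z) z w x = fderiv ℝ (fun z => B z * A z) z w x := by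
    simp only [hc]
  rw [fderiv_mul_apply hA hB, fderiv_mul_apply hB hA] at hcomm
  have hcomm := congr(σ y $hcomm)
  have hT := congr(σ w $(hAB z x y))
  have h1 := dA z x (B z y) w
  have h2 := dB z y (A z x) w
  have sA : ∀ v a b, σ a (fderiv ℝ A z v b) = -σ b (fderiv ℝ A z v a) := fun v a b => by
    rw [← fderiv_symm hA hsA, hσ]
  have sB : ∀ v a b, σ a (fderiv ℝ B z v b) = -σ b (fderiv ℝ B z v a) := fun v a b => by
    rw [← fderiv_symm hB hsB, hσ]
  simp only [dform, fderiv_mul_apply hA hB, torsion, map_add, map_sub, map_zero, ← hsA,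
    ← hsB] at *
  have e1 := sA (B z y) x w
  have e2 := sB y w (A z x)
  have e3 := sB (A z x) y w
  have e4 := sB w (A z x) y
  have e5 := sA y x (B z w)
  linarith

theorem dform_pow {R : E → E →L[ℝ] E} (hσ : ∀ x y, σ x y = -σ y x) (hR : Differentiable ℝ R)
    (hs : ∀ z x y, σ (R z x) y = σ x (R z y)) (hT : ∀ z x y, torsion R R z x y = 0)
    (hd : ∀ z x y w, dform σ R z x y w = 0) (i : ℕ) (z x y w : E) :
    dform σ (fun z => R z ^ i) z x y w = 0 := by
  induction i generalizing z x y w with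
  | zero => simp [dform]
  | succ i ih =>
    simp only [pow_succ']
    exact dform_mul hσ hR (hR.fun_pow i) hs (fun z => pow_symm (hs z) i)
      (fun z => (Commute.self_pow (R z) i).eq) (torsion_pow_right hR (fun _ => rfl) hT i)
      hd ih z x y w

/-- The Jacobi identity for the bivector `(α, β) ↦ ⟨α, A σ⁻¹ β⟩`. -/
theorem jacobi {A : E → E →L[ℝ] E} (hσ : ∀ x y, σ x y = -σ y x) (hA : Differentiable ℝ A)
    (hs : ∀ z x y, σ (A z x) y = σ x (A z y)) (hT : ∀ z x y, torsion A A z x y = 0)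
    (hd : ∀ z x y w, dform σ A z x y w = 0) (z x y w : E) :
    σ w (fderiv ℝ A z (A z x) y) + σ x (fderiv ℝ A z (A z y) w)
      + σ y (fderiv ℝ A z (A z w) x) = 0 := by
  -- The torsion supplies the derivatives along `A z x` and `A z y`; closedness with `A z w` in the
  -- last slot supplies the third one.
  have hK := congr(σ w $(hT z x y))
  have h1 := hd z x y (A z w)
  have sA : ∀ v a b, σ a (fderiv ℝ A z v b) = -σ b (fderiv ℝ A z v a) := fun v a b => by
    rw [← fderiv_symm hA hs, hσ]
  simp only [dform, torsion, map_add, map_sub, map_zero, ← hs] at *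
  have e1 := sA (A z y) x w
  have e2 := sA y x (A z w)
  linarith

/-- The Lie derivative along `z ↦ B z c` of the bivector `(α, β) ↦ ⟨α, A σ⁻¹ β⟩`. -/
theorem lie_bivector {A B : E → E →L[ℝ] E} (hσ : ∀ x y, σ x y = -σ y x)
    (hB : Differentiable ℝ B)
    (hsA : ∀ z x y, σ (A z x) y = σ x (A z y)) (hsB : ∀ z x y, σ (B z x) y = σ x (B z y))
    (hT : ∀ z x y, torsion B A z x y = 0)
    (hd : ∀ z x y w, dform σ B z x y w = 0) (c z x y : E) :
    σ x (fderiv ℝ A z (B z c) y) - σ x (fderiv ℝ B z (A z y) c)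
      + σ y (fderiv ℝ B z (A z x) c)
      = σ x (B z (fderiv ℝ A z c y)) - σ x (A z (fderiv ℝ B z c y)) := by
  -- Torsion and closedness remove every derivative along a moving direction. Only derivatives along
  -- the constant `c` survive, and the Euler relation evaluates those.
  have hK := congr(σ x $(hT z c y))
  have h1 := hd z c y (A z x)
  have sB : ∀ v a b, σ a (fderiv ℝ B z v b) = -σ b (fderiv ℝ B z v a) := fun v a b => by
    rw [← fderiv_symm hB hsB, hσ]
  simp only [dform, torsion, map_add, map_sub, map_zero, ← hsA, ← hsB] at *
  have e2 := sB y c (A z x)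
  linarith

theorem fderiv_pow_euler {R : E → E →L[ℝ] E} (hR : Differentiable ℝ R) {c z : E}
    (hc : fderiv ℝ R z c = R z) (m : ℕ) : fderiv ℝ (fun z => R z ^ m) z c = (m : ℝ) • R z ^ m := by
  induction m with
  | zero => simp
  | succ m ih =>
    ext x
    simp only [pow_succ']
    rw [fderiv_mul_apply hR (hR.fun_pow m), ih, hc]
    simp only [smul_apply, mul_apply_eq_comp, map_smul]
    push_cast
    module

/-! ### The operator of a chain of exponentials -/

/-- The elementary endomorphism `b_k ∧ b_{k+1}` composed with the symplectic form. -/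
noncomputable def chainTerm (σ : E →L[ℝ] E →L[ℝ] ℝ) (b : ℕ → E) (k : ℕ) : E →L[ℝ] E :=
  (σ (b (k + 1))).smulRight (b k) - (σ (b k)).smulRight (b (k + 1))

/-- The operator `∑ exp (σ(b_k) - σ(b_{k+1})) b_k ∧ b_{k+1}` of a chain `b_0, …, b_N`. -/
noncomputable def chainOp (σ : E →L[ℝ] E →L[ℝ] ℝ) (b : ℕ → E) (N : ℕ) (z : E) : E →L[ℝ] E :=
  ∑ k ∈ Finset.range N, Real.exp (σ (b k) z - σ (b (k + 1)) z) • chainTerm σ b k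

variable {σ : E →L[ℝ] E →L[ℝ] ℝ} {b : ℕ → E} {N : ℕ}

theorem chainTerm_apply (k : ℕ) (x : E) :
    chainTerm σ b k x = σ (b (k + 1)) x • b k - σ (b k) x • b (k + 1) := by
  simp [chainTerm]

theorem hasFDerivAt_chainOp (z : E) :
    HasFDerivAt (chainOp σ b N) (∑ k ∈ Finset.range N,
      ((Real.exp (σ (b k) z - σ (b (k + 1)) z)) • (σ (b k) - σ (b (k + 1)))).smulRight
        (chainTerm σ b k)) z := by
  unfold chainOp
  refine HasFDerivAt.fun_sum fun k _ => ?_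
  refine HasFDerivAt.smul_const ?_ (chainTerm σ b k)
  exact (((σ (b k)).hasFDerivAt.sub (σ (b (k + 1))).hasFDerivAt).exp)

theorem contDiff_chainOp : ContDiff ℝ ∞ (chainOp σ b N) := by
  unfold chainOp
  fun_prop

theorem differentiable_chainOp : Differentiable ℝ (chainOp σ b N) :=
  fun z => (hasFDerivAt_chainOp z).differentiableAt

theorem fderiv_chainOp_apply (z v x : E) :
    fderiv ℝ (chainOp σ b N) z v x = ∑ k ∈ Finset.range N,
      (Real.exp (σ (b k) z - σ (b (k + 1)) z) * (σ (b k) v - σ (b (k + 1)) v))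
        • chainTerm σ b k x := by
  rw [(hasFDerivAt_chainOp z).fderiv]
  simp [sum_apply]

theorem chainOp_apply (z x : E) :
    chainOp σ b N z x = ∑ k ∈ Finset.range N,
      Real.exp (σ (b k) z - σ (b (k + 1)) z) • chainTerm σ b k x := by
  simp [chainOp, sum_apply]

theorem fderiv_chainOp_euler {c : E} (hc : ∀ k < N, σ (b k) c - σ (b (k + 1)) c = 1) (z : E) :
    fderiv ℝ (chainOp σ b N) z c = chainOp σ b N z := by
  ext x
  rw [fderiv_chainOp_apply, chainOp_apply]
  refine Finset.sum_congr rfl fun k hk => ?_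
  rw [hc k (Finset.mem_range.1 hk), mul_one]

theorem chainTerm_symm (hσ : ∀ x y, σ x y = -σ y x) (k : ℕ) (x y : E) :
    σ (chainTerm σ b k x) y = σ x (chainTerm σ b k y) := by
  simp only [chainTerm_apply, map_sub, map_smul, sub_apply, smul_apply, smul_eq_mul,
    hσ x (b _)]
  ring

theorem chainOp_symm (hσ : ∀ x y, σ x y = -σ y x) (z x y : E) :
    σ (chainOp σ b N z x) y = σ x (chainOp σ b N z y) := by
  simp only [chainOp_apply, map_sum, map_smul, sum_apply, smul_apply, chainTerm_symm hσ]

/-- Each link contributes, up to sign, the form e^{α-β} α ∧ β with α = σ(b_k), β = σ(b_{k+1}), and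
(α - β) ∧ α ∧ β = 0. -/
theorem dform_chainOp (hσ : ∀ x y, σ x y = -σ y x) (z x y w : E) :
    dform σ (chainOp σ b N) z x y w = 0 := by
  simp only [dform, fderiv_chainOp_apply, map_sum, ← Finset.sum_add_distrib]
  refine Finset.sum_eq_zero fun k _ => ?_
  simp only [chainTerm_apply, map_smul, map_sub, smul_eq_mul, hσ _ (b k), hσ _ (b (k + 1))]
  ring

theorem sum_sum_eq_zero_of_antisymm {s : Finset ℕ} {F : ℕ → ℕ → E}
    (h : ∀ k ∈ s, ∀ l ∈ s, F k l + F l k = 0) : ∑ k ∈ s, ∑ l ∈ s, F k l = 0 := by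
  have h1 : ∑ k ∈ s, ∑ l ∈ s, (F k l + F l k) = 0 :=
    Finset.sum_eq_zero fun k hk => Finset.sum_eq_zero fun l hl => h k hk l hl
  simp only [Finset.sum_add_distrib] at h1
  rw [Finset.sum_comm (f := fun k l => F l k), ← two_smul ℝ] at h1
  exact (smul_eq_zero.1 h1).resolve_left two_ne_zero

/-- The contribution of a pair of links to the torsion of `chainOp`. -/
noncomputable def chainTorsion (σ : E →L[ℝ] E →L[ℝ] ℝ) (b : ℕ → E) (x y : E) (k l : ℕ) : E :=
  σ (b k - b (k + 1)) (chainTerm σ b l x) • chainTerm σ b k y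
    - σ (b k - b (k + 1)) (chainTerm σ b l y) • chainTerm σ b k x
    + chainTerm σ b l (σ (b k - b (k + 1)) y • chainTerm σ b k x
      - σ (b k - b (k + 1)) x • chainTerm σ b k y)

/-- All pairings between distinct vectors are ±1 by order, so only the relative position of the two
links matters: equal, adjacent or disjoint. -/
theorem chainTorsion_antisymm
    (hlt : ∀ k m, k ≤ N → m ≤ N → k < m → σ (b k) (b m) = -1)
    (hgt : ∀ k m, k ≤ N → m ≤ N → m < k → σ (b k) (b m) = 1)
    (hself : ∀ k, σ (b k) (b k) = 0) (x y : E) {k l : ℕ} (hk : k < N) (hl : l < N) :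
    chainTorsion σ b x y k l + chainTorsion σ b x y l k = 0 := by
  wlog hkl : k ≤ l generalizing k l
  · rw [add_comm]; exact this hl hk (by omega)
  simp only [chainTorsion, chainTerm_apply, map_sub, map_smul, sub_apply, smul_eq_mul]
  rcases hkl.eq_or_lt with rfl | hkl
  · rw [hlt k (k + 1) (by omega) (by omega) (by omega),
      hgt (k + 1) k (by omega) (by omega) (by omega)]
    simp only [hself]
    module
  -- Adjacent links share b_{k+1}, and here the two contributions cancel against each other. For
  -- disjoint links b_k - b_{k+1} pairs to zero with the other link, and each contribution vanishes
  -- separately.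
  rcases (Nat.succ_le_of_lt hkl).eq_or_lt with rfl | hkl2
  · simp only [Nat.succ_eq_add_one] at *
    rw [hlt k (k + 1) (by omega) (by omega) (by omega),
      hgt (k + 1) k (by omega) (by omega) (by omega),
      hlt k (k + 1 + 1) (by omega) (by omega) (by omega),
      hgt (k + 1 + 1) k (by omega) (by omega) (by omega),
      hlt (k + 1) (k + 1 + 1) (by omega) (by omega) (by omega),
      hgt (k + 1 + 1) (k + 1) (by omega) (by omega) (by omega)]
    simp only [hself]
    module
  · rw [hlt k l (by omega) (by omega) (by omega), hgt l k (by omega) (by omega) (by omega),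
      hlt (k + 1) l (by omega) (by omega) (by omega),
      hgt l (k + 1) (by omega) (by omega) (by omega),
      hlt k (l + 1) (by omega) (by omega) (by omega),
      hgt (l + 1) k (by omega) (by omega) (by omega),
      hlt (k + 1) (l + 1) (by omega) (by omega) (by omega),
      hgt (l + 1) (k + 1) (by omega) (by omega) (by omega)]
    module

/-- Torsion is quadratic in the operator, hence a sum over ordered pairs of links. The weights `e k
* e l` are symmetric, so only the symmetrised contribution counts. -/
theorem torsion_chainOp
    (hlt : ∀ k m, k ≤ N → m ≤ N → k < m → σ (b k) (b m) = -1)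
    (hgt : ∀ k m, k ≤ N → m ≤ N → m < k → σ (b k) (b m) = 1)
    (hself : ∀ k, σ (b k) (b k) = 0) (z x y : E) :
    torsion (chainOp σ b N) (chainOp σ b N) z x y = 0 := by
  set e : ℕ → ℝ := fun k => Real.exp (σ (b k) z - σ (b (k + 1)) z) with he
  have key : torsion (chainOp σ b N) (chainOp σ b N) z x y
      = ∑ k ∈ Finset.range N, ∑ l ∈ Finset.range N, (e k * e l) • chainTorsion σ b x y k l := by
    have hs : ∀ k v, σ (b k) v - σ (b (k + 1)) v = σ (b k - b (k + 1)) v := by simp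
    have h1 : ∀ v x : E, fderiv ℝ (chainOp σ b N) z (chainOp σ b N z v) x
        = ∑ k ∈ Finset.range N, ∑ l ∈ Finset.range N,
          (e k * e l) • (σ (b k - b (k + 1)) (chainTerm σ b l v) • chainTerm σ b k x) := by
      intro v x
      rw [fderiv_chainOp_apply]
      refine Finset.sum_congr rfl fun k _ => ?_
      rw [hs k (chainOp σ b N z v), chainOp_apply, map_sum, Finset.mul_sum, Finset.sum_smul]
      refine Finset.sum_congr rfl fun l _ => ?_
      rw [map_smul, smul_smul, smul_eq_mul, mul_assoc]
    have h2 : ∀ v x : E, chainOp σ b N z (fderiv ℝ (chainOp σ b N) z v x)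
        = ∑ k ∈ Finset.range N, ∑ l ∈ Finset.range N,
          (e k * e l) • (chainTerm σ b l (σ (b k - b (k + 1)) v • chainTerm σ b k x)) := by
      intro v x
      rw [fderiv_chainOp_apply, map_sum]
      refine Finset.sum_congr rfl fun k _ => ?_
      rw [hs k v, chainOp_apply]
      refine Finset.sum_congr rfl fun l _ => ?_
      simp only [map_smul, smul_smul, he]
      congr 1
      ring
    simp only [torsion, h1, h2, ← Finset.sum_add_distrib, ← Finset.sum_sub_distrib, ← smul_add,
      ← smul_sub, chainTorsion, map_sub]
    refine Finset.sum_congr rfl fun k _ => Finset.sum_congr rfl fun l _ => ?_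
    congr 1
    abel
  rw [key]
  refine sum_sum_eq_zero_of_antisymm fun k hk l hl => ?_
  rw [mul_comm (e l), ← smul_add, chainTorsion_antisymm hlt hgt hself x y
    (Finset.mem_range.1 hk) (Finset.mem_range.1 hl), smul_zero]

end Nijenhuis

namespace KM

theorem minSmoothness_two_le : minSmoothness ℝ 2 ≤ ∞ := by
  rw [minSmoothness_of_isRCLikeNormedField]
  exact WithTop.coe_le_coe.2 (le_top : (2 : ℕ∞) ≤ ⊤)

/-! ### Brackets and Lie derivatives in coordinate-free form -/

section TensorCalculus

set_option linter.unusedSectionVars false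

variable {ι : Type*} [Fintype ι] [DecidableEq ι]

theorem fderiv_eq_grad_dotProduct (f : (ι → ℝ) → ℝ) (x v : ι → ℝ) :
    fderiv ℝ f x v = grad f x ⬝ᵥ v := by
  conv_lhs => rw [pi_eq_sum_univ' v]
  simp [dotProduct, grad, map_sum, mul_comm]

theorem bracket_eq_dotProduct (J : (ι → ℝ) → Matrix ι ι ℝ) (f g : (ι → ℝ) → ℝ) (x : ι → ℝ) :
    bracket J f g x = grad f x ⬝ᵥ (J x).mulVec (grad g x) := by
  simp only [bracket, dotProduct, Matrix.mulVec, Finset.mul_sum]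
  refine Finset.sum_congr rfl fun a _ => Finset.sum_congr rfl fun b _ => ?_
  ring

theorem bracket_eq_fderiv (J : (ι → ℝ) → Matrix ι ι ℝ) (f g : (ι → ℝ) → ℝ) (x : ι → ℝ) :
    bracket J f g x = fderiv ℝ f x ((J x).mulVec (grad g x)) := by
  rw [fderiv_eq_grad_dotProduct, bracket_eq_dotProduct]

theorem grad_proj (a : ι) (x : ι → ℝ) : grad (fun y : ι → ℝ => y a) x = Pi.single a 1 := by
  funext c
  have h : HasFDerivAt (fun y : ι → ℝ => y a) (ContinuousLinearMap.proj (R := ℝ) a) x :=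
    (ContinuousLinearMap.proj (R := ℝ) (φ := fun _ : ι => ℝ) a).hasFDerivAt
  rw [grad, h.fderiv]
  simp [Pi.single_apply, eq_comm]

theorem grad_const_mul (c : ℝ) {f : (ι → ℝ) → ℝ} {x : ι → ℝ} (hf : DifferentiableAt ℝ f x) :
    grad (fun y => c * f y) x = c • grad f x := by
  funext a
  simp [grad, fderiv_const_mul hf]

theorem contDiff_grad {f : (ι → ℝ) → ℝ} (hf : ContDiff ℝ ∞ f) : ContDiff ℝ ∞ (grad f) :=
  contDiff_pi.2 fun _ => (hf.fderiv_right (by simp)).clm_apply contDiff_const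

theorem fderiv_grad {f : (ι → ℝ) → ℝ} (hf : ContDiff ℝ ∞ f) (x v w : ι → ℝ) :
    fderiv ℝ (grad f) x v ⬝ᵥ w = fderiv ℝ (fderiv ℝ f) x v w := by
  have hd : Differentiable ℝ (fderiv ℝ f) := (hf.fderiv_right (m := ∞) (by simp)).differentiable
    (by simp)
  have h : ∀ a, fderiv ℝ (grad f) x v a = fderiv ℝ (fderiv ℝ f) x v (Pi.single a 1) := by
    intro a
    have h1 : HasFDerivAt (grad f) (ContinuousLinearMap.pi fun a =>
        (fderiv ℝ (fderiv ℝ f) x).flip (Pi.single a 1)) x :=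
      hasFDerivAt_pi.2 fun a =>
        ((hd x).hasFDerivAt.clm_apply (hasFDerivAt_const _ _)).congr_fderiv (by ext; simp)
    rw [h1.fderiv]
    simp
  conv_rhs => rw [pi_eq_sum_univ' w]
  simp [dotProduct, h, map_sum, mul_comm]

theorem snd_fderiv_symm {f : (ι → ℝ) → ℝ} (hf : ContDiff ℝ ∞ f) (x v w : ι → ℝ) :
    fderiv ℝ (fderiv ℝ f) x v w = fderiv ℝ (fderiv ℝ f) x w v :=
  (hf.contDiffAt.isSymmSndFDerivAt minSmoothness_two_le).eq v w

variable {J : (ι → ℝ) → Matrix ι ι ℝ} {P : (ι → ℝ) → (ι → ℝ) →L[ℝ] (ι → ℝ)}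

theorem dotProduct_clm_skew (hP : ∀ y w, (J y).mulVec w = P y w) (hs : ∀ y a b, J y b a = -J y a b)
    (y v w : ι → ℝ) : v ⬝ᵥ P y w = -(w ⬝ᵥ P y v) := by
  have h : (J y).transpose = -J y := by ext a b; simp [hs y a b]
  rw [← hP, ← hP, Matrix.dotProduct_mulVec, ← Matrix.mulVec_transpose, h, Matrix.neg_mulVec,
    neg_dotProduct, dotProduct_comm]

theorem contDiff_bracket (hP : ∀ y w, (J y).mulVec w = P y w) (hPd : ContDiff ℝ ∞ P)
    {f g : (ι → ℝ) → ℝ} (hf : ContDiff ℝ ∞ f) (hg : ContDiff ℝ ∞ g) :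
    ContDiff ℝ ∞ (bracket J f g) := by
  have h : bracket J f g = fun y => fderiv ℝ f y (P y (grad g y)) := by
    funext y; rw [bracket_eq_fderiv, hP]
  rw [h]
  exact (hf.fderiv_right (by simp)).clm_apply (hPd.clm_apply (contDiff_grad hg))

/-- Skewness moves `P` off the derivative of `grad g`, so the Hessians of `f` and `g` enter
symmetrically and can later cancel. -/
theorem fderiv_bracket (hP : ∀ y w, (J y).mulVec w = P y w) (hPd : ContDiff ℝ ∞ P)
    (hs : ∀ y a b, J y b a = -J y a b)
    {f g : (ι → ℝ) → ℝ} (hf : ContDiff ℝ ∞ f) (hg : ContDiff ℝ ∞ g) (x v : ι → ℝ) :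
    fderiv ℝ (bracket J f g) x v
      = fderiv ℝ (fderiv ℝ f) x v (P x (grad g x)) - fderiv ℝ (fderiv ℝ g) x v (P x (grad f x))
        + grad f x ⬝ᵥ fderiv ℝ P x v (grad g x) := by
  have h : bracket J f g = fun y => fderiv ℝ f y (P y (grad g y)) := by
    funext y; rw [bracket_eq_fderiv, hP]
  have h1 : DifferentiableAt ℝ (fderiv ℝ f) x :=
    (hf.fderiv_right (m := ∞) (by simp)).differentiable (by simp) x
  have h2 : DifferentiableAt ℝ P x := hPd.differentiable (by simp) x
  have h3 : DifferentiableAt ℝ (grad g) x := (contDiff_grad hg).differentiable (by simp) x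
  rw [h, (h1.hasFDerivAt.clm_apply (h2.hasFDerivAt.clm_apply h3.hasFDerivAt)).fderiv]
  have e : fderiv ℝ f x (P x (fderiv ℝ (grad g) x v))
      = -fderiv ℝ (fderiv ℝ g) x v (P x (grad f x)) := by
    rw [fderiv_eq_grad_dotProduct, dotProduct_clm_skew hP hs, fderiv_grad hg]
  have e2 : fderiv ℝ f x (fderiv ℝ P x v (grad g x)) = grad f x ⬝ᵥ fderiv ℝ P x v (grad g x) :=
    fderiv_eq_grad_dotProduct _ _ _
  simp [e, e2]
  ring

/-- In the cyclic sum the six Hessian terms cancel in pairs by symmetry of second derivatives,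
leaving the first-order condition `hJac` on `P`. -/
theorem isPoissonOn_univ (hP : ∀ y w, (J y).mulVec w = P y w) (hPd : ContDiff ℝ ∞ P)
    (hs : ∀ y a b, J y b a = -J y a b)
    (hJac : ∀ x α β γ, β ⬝ᵥ fderiv ℝ P x (P x α) γ + γ ⬝ᵥ fderiv ℝ P x (P x β) α
      + α ⬝ᵥ fderiv ℝ P x (P x γ) β = 0) :
    IsPoissonOn Set.univ J := by
  refine ⟨fun a b => ContDiff.contDiffOn ?_, fun x _ => hs x, fun f g k hf hg hk x _ => ?_⟩
  · have h : (fun x => J x a b) = fun x => P x (Pi.single b 1) a := by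
      funext x; rw [← hP]; simp
    rw [h]
    exact contDiff_pi.1 (hPd.clm_apply contDiff_const) a
  · rw [contDiffOn_univ] at hf hg hk
    have h : ∀ f g k : (ι → ℝ) → ℝ, ContDiff ℝ ∞ g → ContDiff ℝ ∞ k →
        bracket J f (bracket J g k) x = -(fderiv ℝ (fderiv ℝ g) x (P x (grad f x)) (P x (grad k x))
          - fderiv ℝ (fderiv ℝ k) x (P x (grad f x)) (P x (grad g x))
          + grad g x ⬝ᵥ fderiv ℝ P x (P x (grad f x)) (grad k x)) := by
      intro f g k hg hk
      rw [← fderiv_bracket hP hPd hs hg hk, bracket_eq_dotProduct, hP, dotProduct_clm_skew hP hs,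
        ← fderiv_eq_grad_dotProduct]
    rw [h f g k hg hk, h g k f hk hf, h k f g hf hg]
    have := hJac x (grad f x) (grad g x) (grad k x)
    rw [snd_fderiv_symm hg x (P x (grad f x)), snd_fderiv_symm hk x (P x (grad f x)),
      snd_fderiv_symm hf x (P x (grad g x))]
    linarith

/-- The Lie derivative becomes the failure of `X` to be a derivation of the bracket, a form that
pulls back along the Volterra map without choosing coordinates. -/
theorem lieDeriv_eq_bracket (X : (ι → ℝ) → ι → ℝ) (J : (ι → ℝ) → Matrix ι ι ℝ) (x : ι → ℝ)
    (a b : ι) :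
    lieDeriv X J x a b = deriv X (bracket J (fun y => y a) (fun y => y b)) x
      - bracket J (fun y => X y a) (fun y => y b) x
      - bracket J (fun y => y a) (fun y => X y b) x := by
  have h : bracket J (fun y => y a) (fun y => y b) = fun y => J y a b := by
    funext y
    simp [bracket_eq_dotProduct, grad_proj]
  rw [h]
  simp only [lieDeriv, Matrix.of_apply, deriv]
  congr 1
  · congr 1
    simp [bracket_eq_dotProduct, grad_proj, dotProduct]
  · rw [bracket_eq_dotProduct, grad_proj, single_one_dotProduct]
    simp [dotProduct, Matrix.mulVec, mul_comm]

theorem fderiv_deriv {X : (ι → ℝ) → ι → ℝ} (hX : ContDiff ℝ ∞ X) {f : (ι → ℝ) → ℝ}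
    (hf : ContDiff ℝ ∞ f) (x v : ι → ℝ) :
    fderiv ℝ (deriv X f) x v
      = fderiv ℝ (fderiv ℝ f) x v (X x) + grad f x ⬝ᵥ fderiv ℝ X x v := by
  have h1 : DifferentiableAt ℝ (fderiv ℝ f) x :=
    (hf.fderiv_right (m := ∞) (by simp)).differentiable (by simp) x
  have h2 : DifferentiableAt ℝ X x := hX.differentiable (by simp) x
  have h : deriv X f = fun y => fderiv ℝ f y (X y) := rfl
  rw [h, (h1.hasFDerivAt.clm_apply h2.hasFDerivAt).fderiv, ← fderiv_eq_grad_dotProduct]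
  simp
  ring

/-- The Lie derivative of a skew tensor, evaluated on the differentials of two functions. -/
theorem deriv_bracket_sub (hP : ∀ y w, (J y).mulVec w = P y w) (hPd : ContDiff ℝ ∞ P)
    (hs : ∀ y a b, J y b a = -J y a b) {X : (ι → ℝ) → ι → ℝ} (hX : ContDiff ℝ ∞ X)
    {f g : (ι → ℝ) → ℝ} (hf : ContDiff ℝ ∞ f) (hg : ContDiff ℝ ∞ g) (x : ι → ℝ) :
    deriv X (bracket J f g) x - bracket J (deriv X f) g x - bracket J f (deriv X g) x
      = grad f x ⬝ᵥ fderiv ℝ P x (X x) (grad g x) - grad f x ⬝ᵥ fderiv ℝ X x (P x (grad g x))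
        + grad g x ⬝ᵥ fderiv ℝ X x (P x (grad f x)) := by
  have h1 : bracket J f (deriv X g) x = -fderiv ℝ (deriv X g) x (P x (grad f x)) := by
    rw [bracket_eq_dotProduct, hP, dotProduct_clm_skew hP hs, ← fderiv_eq_grad_dotProduct]
  rw [deriv, fderiv_bracket hP hPd hs hf hg, bracket_eq_fderiv, hP, h1, fderiv_deriv hX hf,
    fderiv_deriv hX hg, snd_fderiv_symm hf x (X x), snd_fderiv_symm hg x (X x)]
  ring

/-- Hamiltonian vector fields of functions in involution commute. -/
theorem lieBracket_hamiltonian_eq_zero {P₀ : (ι → ℝ) →L[ℝ] (ι → ℝ)}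
    (hP : ∀ y w, (J y).mulVec w = P₀ w) (hs : ∀ y a b, J y b a = -J y a b)
    {f g : (ι → ℝ) → ℝ} (hf : ContDiff ℝ ∞ f) (hg : ContDiff ℝ ∞ g)
    (hfg : ∀ x, bracket J f g x = 0) (x : ι → ℝ) :
    VectorField.lieBracket ℝ (fun y => P₀ (grad f y)) (fun y => P₀ (grad g y)) x = 0 := by
  have h1 : ∀ {f : (ι → ℝ) → ℝ}, ContDiff ℝ ∞ f → ∀ v,
      fderiv ℝ (fun y => P₀ (grad f y)) x v = P₀ (fderiv ℝ (grad f) x v) := by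
    intro f hf v
    have := (P₀.hasFDerivAt (x := grad f x)).comp x
      ((contDiff_grad hf).differentiable (by simp) x).hasFDerivAt
    exact congr($(this.fderiv) v)
  -- Differentiating the identically zero bracket, with a constant tensor, equates the two Hessian
  -- terms that make up the Lie bracket.
  have h2 : bracket J f g = fun _ => 0 := funext hfg
  have h3 := fun v => fderiv_bracket (P := fun _ => P₀) hP contDiff_const hs hf hg x v
  simp only [h2, fderiv_fun_const, Pi.zero_apply, zero_apply, dotProduct_zero, add_zero] at h3
  rw [VectorField.lieBracket_eq]
  simp only [h1 hf, h1 hg, ← map_sub]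
  convert map_zero P₀
  refine dotProduct_eq_zero _ fun v => ?_
  rw [sub_dotProduct, fderiv_grad hf, fderiv_grad hg, snd_fderiv_symm hf, snd_fderiv_symm hg]
  linarith [h3 v]

/-- The Lie bracket of a vector field with a Hamiltonian one. -/
theorem lieBracket_hamiltonian {P₀ : (ι → ℝ) →L[ℝ] (ι → ℝ)}
    (hP : ∀ y w, (J y).mulVec w = P₀ w)
    {X : (ι → ℝ) → ι → ℝ} (hX : ContDiff ℝ ∞ X) {f : (ι → ℝ) → ℝ} (hf : ContDiff ℝ ∞ f)
    (x : ι → ℝ) (a : ι) :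
    VectorField.lieBracket ℝ X (fun y => P₀ (grad f y)) x a
      = deriv X (bracket J (fun y => y a) f) x - bracket J (fun y => X y a) f x := by
  have h : bracket J (fun y => y a) f = fun y => P₀ (grad f y) a := by
    funext y
    simp [bracket_eq_dotProduct, grad_proj, hP]
  have hV : Differentiable ℝ (fun y => P₀ (grad f y)) :=
    (P₀.contDiff.comp (contDiff_grad hf)).differentiable (by simp)
  rw [VectorField.lieBracket_eq, h, deriv, bracket_eq_fderiv, hP,
    fderiv_apply (hV x) a, fderiv_apply (hX.differentiable (by simp) x) a]
  rfl

end TensorCalculus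

/-- The Lie bracket of related vector fields is related. -/
theorem lieBracket_related {E F : Type*} [NormedAddCommGroup E] [NormedSpace ℝ E]
    [NormedAddCommGroup F] [NormedSpace ℝ F] {Φ : E → F} (hΦ : ContDiff ℝ ∞ Φ)
    {X X' : E → E} {Y Y' : F → F} (hX : Differentiable ℝ X) (hX' : Differentiable ℝ X') {x : E}
    (hY : DifferentiableAt ℝ Y (Φ x)) (hY' : DifferentiableAt ℝ Y' (Φ x))
    (h : ∀ y, fderiv ℝ Φ y (X y) = Y (Φ y)) (h' : ∀ y, fderiv ℝ Φ y (X' y) = Y' (Φ y)) :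
    VectorField.lieBracket ℝ Y Y' (Φ x) = fderiv ℝ Φ x (VectorField.lieBracket ℝ X X' x) := by
  have hd : DifferentiableAt ℝ (fderiv ℝ Φ) x :=
    (hΦ.fderiv_right (m := ∞) (by simp)).differentiable (by simp) x
  -- The relation DΦ(X) = Y ∘ Φ is differentiated; the resulting D²Φ terms cancel in the bracket by
  -- symmetry.
  have key : ∀ {X : E → E} {Y : F → F}, Differentiable ℝ X → DifferentiableAt ℝ Y (Φ x) →
      (∀ y, fderiv ℝ Φ y (X y) = Y (Φ y)) → ∀ v, fderiv ℝ Y (Φ x) (fderiv ℝ Φ x v)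
        = fderiv ℝ (fderiv ℝ Φ) x v (X x) + fderiv ℝ Φ x (fderiv ℝ X x v) := by
    intro X Y hX hY h v
    have h1 := hY.hasFDerivAt.comp x (hΦ.differentiable (by simp) x).hasFDerivAt
    have h2 := hd.hasFDerivAt.clm_apply (hX x).hasFDerivAt
    have h3 : (Y ∘ Φ) = fun y => fderiv ℝ Φ y (X y) := by funext y; exact (h y).symm
    rw [h3] at h1
    have := congr($(h1.unique h2) v)
    simp at this
    rw [this, add_comm]
  rw [VectorField.lieBracket_eq, VectorField.lieBracket_eq]
  simp only [← h, ← h']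
  simp only [h, h', map_sub]
  rw [← h, ← h', key hX' hY' h', key hX hY h,
    (hΦ.contDiffAt.isSymmSndFDerivAt minSmoothness_two_le).eq (X x)]
  abel

variable {N : ℕ}

/-! ### The chain of constant vector fields behind `J₃` -/

/-- The `q_i`-component (one-based) of the vector `b_k`. -/
noncomputable def chainQ (k i : ℕ) : ℝ := if i ≤ k then 1 else 0

/-- The `p_i`-component (one-based) of the vector `b_k`. -/
noncomputable def chainP (k i : ℕ) : ℝ :=
  -(1 / 2) * ((if i = 1 then 1 else 0) + (if i = k then 1 else 0) + (if i = k + 1 then 1 else 0))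

/-- The constant vectors `b_0, …, b_N` with `J₃ = ∑ u_k b_{k-1} ∧ b_k`. -/
noncomputable def chainVec (N k : ℕ) : Phase N :=
  Sum.elim (fun i => chainQ k (i + 1)) (fun i => chainP k (i + 1))

theorem coord_of_mem {v : Fin N → ℝ} {k : ℕ} (h1 : 1 ≤ k) (h2 : k ≤ N) :
    coord v k = v ⟨k - 1, by omega⟩ := by
  simp [coord, h1, h2]

theorem coord_of_lt {v : Fin N → ℝ} {k : ℕ} (h : k < N) : coord v (k + 1) = v ⟨k, h⟩ := by
  rw [coord_of_mem (by omega) (by omega)]; rfl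

theorem coord_of_not_mem {v : Fin N → ℝ} {k : ℕ} (h : ¬(1 ≤ k ∧ k ≤ N)) : coord v k = 0 := by
  simp [coord, h]

theorem coord_succ (v : Fin N → ℝ) (i : Fin N) : coord v (i + 1) = v i := coord_of_lt i.2

theorem sum_ite_mul_eq_coord (v : Fin N → ℝ) (k : ℕ) :
    ∑ i : Fin N, (if (i : ℕ) + 1 = k then 1 else 0) * v i = coord v k := by
  by_cases h : 1 ≤ k ∧ k ≤ N
  · rw [coord_of_mem h.1 h.2, Finset.sum_eq_single ⟨k - 1, by omega⟩]
    · simp [h.1]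
    · intro i _ hi
      rw [if_neg, zero_mul]
      intro hk
      exact hi (Fin.ext (by simp; omega))
    · simp
  · rw [coord_of_not_mem h]
    refine Finset.sum_eq_zero fun i _ => ?_
    rw [if_neg (by omega), zero_mul]

theorem sum_range_mul_ite (x : Phase N) (m : ℕ) :
    ∑ k ∈ Finset.range N, u x (k + 1) * (if k + 1 = m then 1 else 0) = u x m := by
  rw [← Fin.sum_univ_eq_sum_range (fun k => u x (k + 1) * (if k + 1 = m then 1 else 0))]
  simp only [u, coord_succ]
  rw [← sum_ite_mul_eq_coord]
  simp only [mul_comm]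

theorem qqBracket_eq_sum (x : Phase N) (i j : ℕ) :
    qqBracket x i j = ∑ k ∈ Finset.range N,
      u x (k + 1) * (chainQ k i * chainQ (k + 1) j - chainQ (k + 1) i * chainQ k j) := by
  have h : ∀ k, chainQ k i * chainQ (k + 1) j - chainQ (k + 1) i * chainQ k j
      = (if i < j then 1 else 0) * (if k + 1 = j then 1 else 0)
        - (if j < i then 1 else 0) * (if k + 1 = i then 1 else 0) := by
    intro k; simp only [chainQ]; grind
  simp only [h, mul_sub, Finset.sum_sub_distrib, mul_left_comm (u x _), ← Finset.mul_sum,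
    sum_range_mul_ite, qqBracket]
  grind

/-- `chainQ k i` jumps once and `chainP k j` has at most three nonzero contributions, so the sum
collapses to single values of u. The exceptional terms with j = 1 come from the entry -1/2 that
every chain vector has at p_1. -/
theorem qpBracket_eq_sum (x : Phase N) {i j : ℕ} (hi : 1 ≤ i) (hj : 1 ≤ j) :
    qpBracket x i j = ∑ k ∈ Finset.range N,
      u x (k + 1) * (chainQ k i * chainP (k + 1) j - chainQ (k + 1) i * chainP k j) := by
  have h : ∀ k, chainQ k i * chainP (k + 1) j - chainQ (k + 1) i * chainP k j
      = (if j = 1 then 1 / 2 else 0) * (if k + 1 = i then 1 else 0)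
        + (if i = j then 1 / 2 else 0) * (if k + 1 = j then 1 else 0)
        + (if i ≤ j + 1 then 1 / 2 else 0) * (if k + 1 = j + 1 then 1 else 0)
        - (if i + 2 ≤ j then 1 / 2 else 0) * (if k + 1 = j - 1 then 1 else 0) := by
    intro k; simp only [chainQ, chainP]; grind
  simp only [h, mul_sub, mul_add, Finset.sum_add_distrib, Finset.sum_sub_distrib,
    mul_left_comm (u x _), ← Finset.mul_sum, sum_range_mul_ite, qpBracket]
  grind

theorem ppUpper_eq_sum (x : Phase N) {i j : ℕ} (hi : 1 ≤ i) (hj : i < j) :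
    ppUpper x i j = ∑ k ∈ Finset.range N,
      u x (k + 1) * (chainP k i * chainP (k + 1) j - chainP (k + 1) i * chainP k j) := by
  have h : ∀ k, chainP k i * chainP (k + 1) j - chainP (k + 1) i * chainP k j
      = (if i = 1 then 1 / 4 else 0) * (if k + 1 = j - 1 then 1 else 0)
        - (if i = 1 then 1 / 4 else 0) * (if k + 1 = j + 1 then 1 else 0)
        + (if j = i + 1 then 1 / 4 else 0) * (if k + 1 = j then 1 else 0)
        + (if j = i + 1 then 1 / 4 else 0) * (if k + 1 = i then 1 else 0)
        + (if j = i + 2 then 1 / 4 else 0) * (if k + 1 = i + 1 then 1 else 0) := by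
    intro k; simp only [chainP]; grind (splits := 14)
  simp only [h, mul_sub, mul_add, Finset.sum_add_distrib, Finset.sum_sub_distrib,
    mul_left_comm (u x _), ← Finset.mul_sum, sum_range_mul_ite, ppUpper]
  grind

theorem ppBracket_eq_sum (x : Phase N) {i j : ℕ} (hi : 1 ≤ i) (hj : 1 ≤ j) :
    ppBracket x i j = ∑ k ∈ Finset.range N,
      u x (k + 1) * (chainP k i * chainP (k + 1) j - chainP (k + 1) i * chainP k j) := by
  unfold ppBracket
  split_ifs with h1 h2
  · exact ppUpper_eq_sum x hi h1
  · rw [ppUpper_eq_sum x hj h2, ← Finset.sum_neg_distrib]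
    exact Finset.sum_congr rfl fun k _ => by ring
  · obtain rfl : i = j := by omega
    exact (Finset.sum_eq_zero fun k _ => by ring).symm

/-- The case table is absorbed here into N wedges of constant vectors. Later arguments about `J₃`
use only this form. -/
theorem J₃_apply (x : Phase N) (a c : Fin N ⊕ Fin N) :
    J₃ N x a c = ∑ k ∈ Finset.range N, u x (k + 1) *
      (chainVec N k a * chainVec N (k + 1) c - chainVec N (k + 1) a * chainVec N k c) := by
  rcases a with i | i <;> rcases c with j | j
  · exact qqBracket_eq_sum x _ _
  · exact qpBracket_eq_sum x (by omega) (by omega)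
  · simp only [J₃, Matrix.fromBlocks_apply₂₁, Matrix.of_apply, chainVec, Sum.elim_inl,
      Sum.elim_inr]
    rw [qpBracket_eq_sum x (by omega) (by omega), ← Finset.sum_neg_distrib]
    exact Finset.sum_congr rfl fun k _ => by ring
  · exact ppBracket_eq_sum x (by omega) (by omega)

/-! ### The symplectic form and the recursion operator -/

/-- The symplectic form `σ(x, y) = x ⬝ J₂⁻¹ y`. -/
noncomputable def sympl (N : ℕ) : Phase N →L[ℝ] Phase N →L[ℝ] ℝ :=
  (LinearMap.mk₂ ℝ
    (fun x y : Phase N => ∑ i, (x (Sum.inr i) * y (Sum.inl i) - x (Sum.inl i) * y (Sum.inr i)))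
    (fun x x' y => by simp only [Pi.add_apply, ← Finset.sum_add_distrib]; congr! 1; ring)
    (fun c x y => by
      simp only [Pi.smul_apply, smul_eq_mul, Finset.mul_sum]; congr! 1; ring)
    (fun x y y' => by simp only [Pi.add_apply, ← Finset.sum_add_distrib]; congr! 1; ring)
    (fun c x y => by
      simp only [Pi.smul_apply, smul_eq_mul, Finset.mul_sum]; congr! 1; ring)).toContinuousBilinearMap

theorem sympl_apply (x y : Phase N) :
    sympl N x y = ∑ i, (x (Sum.inr i) * y (Sum.inl i) - x (Sum.inl i) * y (Sum.inr i)) := rfl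

theorem sympl_skew (x y : Phase N) : sympl N x y = -sympl N y x := by
  simp only [sympl_apply, ← Finset.sum_neg_distrib]
  exact Finset.sum_congr rfl fun i _ => by ring

theorem J₂_mulVec (x v : Phase N) :
    (J₂ N x).mulVec v = Sum.elim (fun i => v (Sum.inr i)) (fun i => -v (Sum.inl i)) := by
  rw [J₂, Matrix.fromBlocks_mulVec]
  simp [Matrix.neg_mulVec]
  rfl

theorem J₂_inv (x : Phase N) : (J₂ N x)⁻¹ = -J₂ N x := by
  refine Matrix.inv_eq_right_inv ?_
  simp [J₂, Matrix.fromBlocks_multiply, Matrix.fromBlocks_neg]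

theorem dotProduct_eq_sympl (x α w : Phase N) :
    α ⬝ᵥ w = -sympl N ((J₂ N x).mulVec α) w := by
  rw [J₂_mulVec, sympl_apply]
  simp [dotProduct, Fintype.sum_sum_type, Finset.sum_add_distrib, sub_eq_add_neg]
  ring

theorem dotProduct_J₂_inv (x α w : Phase N) :
    α ⬝ᵥ ((J₂ N x)⁻¹).mulVec w = sympl N α w := by
  rw [J₂_inv, Matrix.neg_mulVec, J₂_mulVec, sympl_apply]
  simp [dotProduct, Fintype.sum_sum_type, Finset.sum_add_distrib, sub_eq_add_neg]

theorem sympl_chainVec (k : ℕ) (x : Phase N) :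
    sympl N (chainVec N k) x
      = -(1 / 2) * (q x 1 + q x k + q x (k + 1)) - ∑ i : Fin N, chainQ k (i + 1) * x (Sum.inr i) := by
  simp only [sympl_apply, Finset.sum_sub_distrib, chainVec, Sum.elim_inl, Sum.elim_inr, q,
    ← sum_ite_mul_eq_coord, chainP, mul_add, add_mul, Finset.sum_add_distrib, Finset.mul_sum,
    mul_assoc]

theorem q_chainVec (k j : ℕ) :
    q (chainVec N k) j = if 1 ≤ j ∧ j ≤ N ∧ j ≤ k then 1 else 0 := by
  unfold q
  by_cases h : 1 ≤ j ∧ j ≤ N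
  · rw [coord_of_mem h.1 h.2]
    simp only [chainVec, Sum.elim_inl, chainQ, Nat.sub_add_cancel h.1]
    grind
  · rw [coord_of_not_mem h, if_neg (by tauto)]

theorem sympl_chainVec_chainVec (k m : ℕ) :
    sympl N (chainVec N k) (chainVec N m)
      = -(1 / 2) * (q (chainVec N m) 1 + q (chainVec N m) k + q (chainVec N m) (k + 1))
        + (1 / 2) * (q (chainVec N k) 1 + q (chainVec N k) m + q (chainVec N k) (m + 1)) := by
  rw [sympl_chainVec, sub_eq_add_neg]
  congr 1
  simp only [q, ← sum_ite_mul_eq_coord, ← Finset.sum_add_distrib, Finset.mul_sum,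
    ← Finset.sum_neg_distrib]
  refine Finset.sum_congr rfl fun i _ => ?_
  simp only [chainVec, Sum.elim_inr, Sum.elim_inl, chainP]
  ring

theorem sympl_chainVec_self (k : ℕ) : sympl N (chainVec N k) (chainVec N k) = 0 := by
  linarith [sympl_skew (chainVec N k) (chainVec N k)]

/-- The common p_1 entry of the chain vectors makes up for q_0 = 0 when k = 0, so the value is
uniform. The bound m ≤ N keeps q_m out of the region where q is zero by convention. -/
theorem sympl_chainVec_lt {k m : ℕ} (hm : m ≤ N) (h : k < m) :
    sympl N (chainVec N k) (chainVec N m) = -1 := by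
  rw [sympl_chainVec_chainVec]
  simp only [q_chainVec]
  grind

theorem sympl_chainVec_gt {k m : ℕ} (hk : k ≤ N) (h : m < k) :
    sympl N (chainVec N k) (chainVec N m) = 1 := by
  rw [sympl_skew, sympl_chainVec_lt hk h, neg_neg]

/-- The q_1 terms cancel in the difference, leaving exactly log u_{k+1}; this is why the weights of
the chain are exponentials of its own pairings. -/
theorem sympl_chainVec_sub (k : ℕ) (x : Phase N) :
    sympl N (chainVec N k) x - sympl N (chainVec N (k + 1)) x
      = p x (k + 1) + (1 / 2) * (q x (k + 2) - q x k) := by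
  have h : p x (k + 1) = ∑ i : Fin N, chainQ (k + 1) (i + 1) * x (Sum.inr i)
      - ∑ i : Fin N, chainQ k (i + 1) * x (Sum.inr i) := by
    rw [p, ← sum_ite_mul_eq_coord, ← Finset.sum_sub_distrib]
    refine Finset.sum_congr rfl fun i _ => ?_
    rw [← sub_mul, chainQ, chainQ]
    congr 1
    grind
  rw [sympl_chainVec, sympl_chainVec, h]
  ring

theorem u_succ_eq_exp {k : ℕ} (hk : k < N) (x : Phase N) :
    u x (k + 1) = Real.exp (sympl N (chainVec N k) x - sympl N (chainVec N (k + 1)) x) := by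
  rw [u, coord_of_lt hk, volterraMap, sympl_chainVec_sub]

/-- The recursion operator as a field of continuous linear maps. -/
noncomputable def recOp (N : ℕ) (x : Phase N) : Phase N →L[ℝ] Phase N :=
  Nijenhuis.chainOp (sympl N) (chainVec N) N x

theorem R_mulVec (x v : Phase N) : (R N x).mulVec v = recOp N x v := by
  rw [R, ← Matrix.mulVec_mulVec, recOp, Nijenhuis.chainOp_apply]
  funext a
  rw [Matrix.mulVec]
  simp only [dotProduct, J₃_apply, Finset.sum_mul, Finset.sum_apply]
  rw [Finset.sum_comm]
  refine Finset.sum_congr rfl fun k hk => ?_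
  rw [← u_succ_eq_exp (Finset.mem_range.1 hk), Nijenhuis.chainTerm_apply, Pi.smul_apply,
    Pi.sub_apply, Pi.smul_apply, Pi.smul_apply, ← dotProduct_J₂_inv x, ← dotProduct_J₂_inv x]
  simp only [dotProduct, smul_eq_mul, Finset.sum_mul, ← Finset.sum_sub_distrib, Finset.mul_sum]
  exact Finset.sum_congr rfl fun c _ => by ring

theorem R_pow_mulVec (i : ℕ) (x v : Phase N) : (R N x ^ i).mulVec v = (recOp N x ^ i) v := by
  induction i generalizing v with
  | zero => simp
  | succ i ih =>
    rw [pow_succ, ← Matrix.mulVec_mulVec, ih, R_mulVec, pow_succ]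
    rfl

theorem contDiff_recOp : ContDiff ℝ ∞ (recOp N) := Nijenhuis.contDiff_chainOp

theorem differentiable_recOp : Differentiable ℝ (recOp N) := Nijenhuis.differentiable_chainOp

theorem recOp_symm (z x y : Phase N) : sympl N (recOp N z x) y = sympl N x (recOp N z y) :=
  Nijenhuis.chainOp_symm sympl_skew z x y

theorem recOp_pow_symm (i : ℕ) (z x y : Phase N) :
    sympl N ((recOp N z ^ i) x) y = sympl N x ((recOp N z ^ i) y) :=
  Nijenhuis.pow_symm (recOp_symm z) i x y

theorem torsion_recOp (z x y : Phase N) : Nijenhuis.torsion (recOp N) (recOp N) z x y = 0 :=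
  Nijenhuis.torsion_chainOp (fun _ _ _ hm h => sympl_chainVec_lt hm h)
    (fun _ _ hk _ h => sympl_chainVec_gt hk h) sympl_chainVec_self z x y

theorem dform_recOp (z x y w : Phase N) : Nijenhuis.dform (sympl N) (recOp N) z x y w = 0 :=
  Nijenhuis.dform_chainOp sympl_skew z x y w

theorem sympl_X₀ {k : ℕ} (hk : k < N) (z : Phase N) :
    sympl N (chainVec N k) (X₀ N z) - sympl N (chainVec N (k + 1)) (X₀ N z) = 1 := by
  have h : ∀ j, q (X₀ N z) j = 0 := by
    intro j
    simp [q, coord, X₀]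
  rw [sympl_chainVec_sub, h, h, p, coord_of_lt hk]
  simp [X₀]

theorem fderiv_recOp_X₀ (z : Phase N) : fderiv ℝ (recOp N) z (X₀ N z) = recOp N z :=
  Nijenhuis.fderiv_chainOp_euler (fun _ hk => sympl_X₀ hk z) z

theorem fderiv_recOp_pow_X₀ (m : ℕ) (z : Phase N) :
    fderiv ℝ (fun z => recOp N z ^ m) z (X₀ N z) = (m : ℝ) • recOp N z ^ m :=
  Nijenhuis.fderiv_pow_euler differentiable_recOp (fderiv_recOp_X₀ z) m

/-! ### The hierarchy of Poisson tensors and master symmetries on phase space -/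

/-- The canonical tensor `J₂` as a continuous linear map. -/
noncomputable def canonOp (N : ℕ) : Phase N →L[ℝ] Phase N :=
  LinearMap.toContinuousLinearMap (J₂ N 0).mulVecLin

/-- The tensor `J_{m+2} = R^m J₂` as a field of continuous linear maps. -/
noncomputable def tensorOp (N m : ℕ) (x : Phase N) : Phase N →L[ℝ] Phase N :=
  recOp N x ^ m * canonOp N

theorem J₂_mulVec_eq (x w : Phase N) : (J₂ N x).mulVec w = canonOp N w := rfl

theorem tensorOp_apply (m : ℕ) (x w : Phase N) :
    tensorOp N m x w = (recOp N x ^ m) (canonOp N w) := rfl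

theorem J_mulVec (j : ℕ) (x w : Phase N) : (J N j x).mulVec w = tensorOp N (j - 2) x w := by
  rw [J, ← Matrix.mulVec_mulVec, R_pow_mulVec, J₂_mulVec_eq, tensorOp_apply]

theorem dotProduct_eq_sympl_canonOp (α w : Phase N) : α ⬝ᵥ w = -sympl N (canonOp N α) w :=
  dotProduct_eq_sympl 0 α w

theorem contDiff_recOp_pow (m : ℕ) : ContDiff ℝ ∞ (fun x => recOp N x ^ m) :=
  contDiff_recOp.pow m

theorem differentiable_recOp_pow (m : ℕ) : Differentiable ℝ (fun x => recOp N x ^ m) :=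
  differentiable_recOp.fun_pow m

theorem contDiff_tensorOp (m : ℕ) : ContDiff ℝ ∞ (tensorOp N m) :=
  (contDiff_recOp_pow m).mul contDiff_const

theorem fderiv_tensorOp (m : ℕ) (x v w : Phase N) :
    fderiv ℝ (tensorOp N m) x v w = fderiv ℝ (fun x => recOp N x ^ m) x v (canonOp N w) := by
  unfold tensorOp
  rw [Nijenhuis.fderiv_mul_apply (differentiable_recOp_pow m) (differentiable_const _)]
  simp

theorem dotProduct_tensorOp_skew (m : ℕ) (x α β : Phase N) :
    β ⬝ᵥ tensorOp N m x α = -(α ⬝ᵥ tensorOp N m x β) := by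
  rw [dotProduct_eq_sympl_canonOp, dotProduct_eq_sympl_canonOp, tensorOp_apply, tensorOp_apply,
    ← recOp_pow_symm, sympl_skew]

theorem J_apply (j : ℕ) (x : Phase N) (a b : Fin N ⊕ Fin N) :
    J N j x a b = Pi.single a 1 ⬝ᵥ tensorOp N (j - 2) x (Pi.single b 1) := by
  rw [← J_mulVec]
  simp

theorem J_skew (j : ℕ) (x : Phase N) (a b : Fin N ⊕ Fin N) : J N j x b a = -J N j x a b := by
  rw [J_apply, J_apply, dotProduct_tensorOp_skew]

theorem torsion_recOp_pow (i j : ℕ) (z x y : Phase N) :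
    Nijenhuis.torsion (fun z => recOp N z ^ i) (fun z => recOp N z ^ j) z x y = 0 :=
  Nijenhuis.torsion_pow_pow differentiable_recOp torsion_recOp i j z x y

theorem dform_recOp_pow (i : ℕ) (z x y w : Phase N) :
    Nijenhuis.dform (sympl N) (fun z => recOp N z ^ i) z x y w = 0 :=
  Nijenhuis.dform_pow sympl_skew differentiable_recOp recOp_symm torsion_recOp dform_recOp
    i z x y w

theorem isPoissonOn_J (j : ℕ) : IsPoissonOn Set.univ (J N j) := by
  refine isPoissonOn_univ (J_mulVec j) (contDiff_tensorOp _) (J_skew j) fun x α β γ => ?_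
  simp only [fderiv_tensorOp, dotProduct_eq_sympl_canonOp, tensorOp_apply]
  have := Nijenhuis.jacobi sympl_skew (differentiable_recOp_pow (j - 2))
    (recOp_pow_symm (j - 2)) (torsion_recOp_pow _ _) (dform_recOp_pow (j - 2)) x
    (canonOp N α) (canonOp N γ) (canonOp N β)
  linarith

theorem X_eq (i : ℕ) (x : Phase N) : X N i x = (recOp N x ^ i) (X₀ N x) := R_pow_mulVec i x _

theorem contDiff_X (i : ℕ) : ContDiff ℝ ∞ (X N i) := by
  have h : X N i = fun x => (recOp N x ^ i) (X₀ N 0) := funext (X_eq i)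
  rw [h]
  exact (contDiff_recOp_pow i).clm_apply contDiff_const

theorem fderiv_X (i : ℕ) (x v : Phase N) :
    fderiv ℝ (X N i) x v = fderiv ℝ (fun x => recOp N x ^ i) x v (X₀ N x) := by
  have h : X N i = fun x => (recOp N x ^ i) (X₀ N 0) := funext (X_eq i)
  rw [h, ((differentiable_recOp_pow i x).hasFDerivAt.clm_apply (hasFDerivAt_const _ x)).fderiv]
  simp
  rfl

theorem recOp_pow_add_apply (i j : ℕ) (x v : Phase N) :
    (recOp N x ^ (i + j)) v = (recOp N x ^ i) ((recOp N x ^ j) v) := by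
  rw [pow_add]; rfl

theorem lieBracket_X (i j : ℕ) (x : Phase N) :
    VectorField.lieBracket ℝ (X N i) (X N j) x = ((j : ℝ) - i) • X N (i + j) x := by
  -- On the pair (X₀, X₀) the torsion identity is the bracket plus (i - j) R^{i+j} X₀, by the Euler
  -- relation for both powers.
  have h := torsion_recOp_pow i j x (X₀ N x) (X₀ N x)
  rw [VectorField.lieBracket_eq]
  simp only [Nijenhuis.torsion, fderiv_recOp_pow_X₀, smul_apply] at h
  simp only [fderiv_X, X_eq, recOp_pow_add_apply]
  simp only [map_smul, ← recOp_pow_add_apply] at h ⊢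
  rw [add_comm j i] at h
  rw [← sub_eq_zero, ← h]
  module

/-- The Lie derivative of the hierarchy of tensors, evaluated on two functions. -/
theorem deriv_bracket_J (i : ℕ) {j : ℕ} (hj : 2 ≤ j) {f g : Phase N → ℝ} (hf : ContDiff ℝ ∞ f)
    (hg : ContDiff ℝ ∞ g) (x : Phase N) :
    deriv (X N i) (bracket (J N j) f g) x - bracket (J N j) (deriv (X N i) f) g x
      - bracket (J N j) f (deriv (X N i) g) x
      = ((j : ℝ) - i - 2) * bracket (J N (i + j)) f g x := by
  -- J_j is R^m J₂ with m = j - 2, so the weight m - i of the operator identity reads j - i - 2.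
  obtain ⟨m, rfl⟩ := Nat.exists_eq_add_of_le' hj
  rw [deriv_bracket_sub (J_mulVec _) (contDiff_tensorOp _) (J_skew _) (contDiff_X i) hf hg,
    bracket_eq_dotProduct, J_mulVec]
  have h := Nijenhuis.lie_bivector sympl_skew (differentiable_recOp_pow i) (recOp_pow_symm m)
    (recOp_pow_symm i) (torsion_recOp_pow i m) (dform_recOp_pow i) (X₀ N x) x
    (canonOp N (grad f x)) (canonOp N (grad g x))
  simp only [fderiv_recOp_pow_X₀, smul_apply, map_smul, ← recOp_pow_add_apply, add_comm m i,
    smul_eq_mul] at h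
  have e : i + (m + 2) - 2 = i + m := by omega
  simp only [fderiv_tensorOp, fderiv_X, dotProduct_eq_sympl_canonOp, tensorOp_apply, X_eq,
    Nat.add_sub_cancel, e]
  rw [Nat.cast_add, Nat.cast_two]
  linarith

theorem lieDeriv_J (i : ℕ) {j : ℕ} (hj : 2 ≤ j) (x : Phase N) :
    lieDeriv (X N i) (J N j) x = ((j : ℝ) - i - 2) • J N (i + j) x := by
  ext a b
  have hd : ∀ a, deriv (X N i) (fun y => y a) = fun y => X N i y a := by
    intro a
    funext y
    rw [deriv, fderiv_eq_grad_dotProduct, grad_proj, single_one_dotProduct]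
  have h := deriv_bracket_J i hj (f := fun y : Phase N => y a) (g := fun y : Phase N => y b)
    (contDiff_apply ℝ ℝ a) (contDiff_apply ℝ ℝ b) x
  rw [lieDeriv_eq_bracket, ← hd, ← hd, h, Matrix.smul_apply, smul_eq_mul,
    bracket_eq_dotProduct, grad_proj, grad_proj]
  simp

theorem flow_eq (j : ℕ) (x : Phase N) :
    flow N j x = (recOp N x ^ (j - 1)) (canonOp N (grad (h₁ N) x)) := R_pow_mulVec _ x _

theorem dotProduct_recOp_pow (i : ℕ) (x α v : Phase N) :
    α ⬝ᵥ (recOp N x ^ i) v = ((R N x).transpose ^ i).mulVec α ⬝ᵥ v := by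
  rw [← R_pow_mulVec, Matrix.dotProduct_mulVec, ← Matrix.mulVec_transpose, Matrix.transpose_pow]

theorem canonOp_skew (α β : Phase N) : β ⬝ᵥ canonOp N α = -(α ⬝ᵥ canonOp N β) :=
  dotProduct_tensorOp_skew 0 0 α β

/-- Compatibility of the recursion operator with the canonical tensor: `R^i J₂ = J₂ (Rᵀ)^i`. -/
theorem recOp_pow_canonOp (i : ℕ) (x α : Phase N) :
    (recOp N x ^ i) (canonOp N α) = canonOp N (((R N x).transpose ^ i).mulVec α) := by
  refine dotProduct_eq _ _ fun w => ?_
  have h := dotProduct_tensorOp_skew i x α w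
  rw [tensorOp_apply, tensorOp_apply, dotProduct_recOp_pow i x α] at h
  rw [dotProduct_comm, h, dotProduct_comm _ w, canonOp_skew, neg_neg]

theorem J_two_eq : J N 2 = J₂ N := funext J_two

/-! ### The Hamiltonian hierarchy -/

/-- A Lenard sequence of functions on phase space that starts with `h₁`. -/
structure IsLenardSequence (h : ℕ → Phase N → ℝ) : Prop where
  contDiff : ∀ j, 1 ≤ j → ContDiff ℝ ∞ (h j)
  one : h 1 = h₁ N
  grad_succ : ∀ j, 1 ≤ j → ∀ x, grad (h (j + 1)) x = (R N x).transpose.mulVec (grad (h j) x)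
  euler : ∀ j, 1 ≤ j → ∀ x, deriv (X₀ N) (h j) x = j * h j x

namespace IsLenardSequence

variable {h : ℕ → Phase N → ℝ} (hh : IsLenardSequence h)
include hh

theorem grad_add (i : ℕ) {j : ℕ} (hj : 1 ≤ j) (x : Phase N) :
    grad (h (i + j)) x = ((R N x).transpose ^ i).mulVec (grad (h j) x) := by
  induction i with
  | zero => simp
  | succ i ih =>
    rw [add_right_comm, hh.grad_succ _ (by omega), ih, Matrix.mulVec_mulVec, pow_succ']

theorem grad_eq {j : ℕ} (hj : 1 ≤ j) (x : Phase N) :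
    grad (h j) x = ((R N x).transpose ^ (j - 1)).mulVec (grad (h₁ N) x) := by
  rw [← hh.one, ← hh.grad_add _ le_rfl, Nat.sub_add_cancel hj]

theorem canonOp_grad {j : ℕ} (hj : 1 ≤ j) (x : Phase N) :
    canonOp N (grad (h j) x) = flow N j x := by
  rw [flow_eq, recOp_pow_canonOp, ← hh.grad_eq hj]

theorem recOp_pow_canonOp_grad (i : ℕ) {j : ℕ} (hj : 1 ≤ j) (x : Phase N) :
    (recOp N x ^ i) (canonOp N (grad (h j) x)) = flow N (i + j) x := by
  rw [recOp_pow_canonOp, ← hh.grad_add i hj, hh.canonOp_grad (by omega)]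

/-- Moving all powers of R to one side turns the bracket into dh₁ paired with itself under some R^m
J₂, and these tensors are skew. -/
theorem bracket_eq_zero {i k : ℕ} (j : ℕ) (hi : 1 ≤ i) (hk : 1 ≤ k) (x : Phase N) :
    bracket (J N j) (h i) (h k) x = 0 := by
  rw [bracket_eq_dotProduct, J_mulVec, tensorOp_apply, hh.grad_eq hi, hh.grad_eq hk,
    ← recOp_pow_canonOp, ← dotProduct_recOp_pow, ← recOp_pow_add_apply, ← recOp_pow_add_apply]
  have := dotProduct_tensorOp_skew (i - 1 + (j - 2) + (k - 1)) x (grad (h₁ N) x) (grad (h₁ N) x)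
  rw [tensorOp_apply] at this
  linarith

theorem flow_eq_canonOp {j : ℕ} (hj : 1 ≤ j) : flow N j = fun x => canonOp N (grad (h j) x) :=
  funext fun x => (hh.canonOp_grad hj x).symm

theorem contDiff_flow {j : ℕ} (hj : 1 ≤ j) : ContDiff ℝ ∞ (flow N j) := by
  rw [hh.flow_eq_canonOp hj]
  exact (canonOp N).contDiff.comp (contDiff_grad (hh.contDiff j hj))

theorem lieBracket_flow {i j : ℕ} (hi : 1 ≤ i) (hj : 1 ≤ j) (x : Phase N) :
    VectorField.lieBracket ℝ (flow N i) (flow N j) x = 0 := by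
  rw [hh.flow_eq_canonOp hi, hh.flow_eq_canonOp hj]
  refine lieBracket_hamiltonian_eq_zero (J := J N 2) (J_mulVec 2) (J_skew 2) (hh.contDiff i hi)
    (hh.contDiff j hj) (hh.bracket_eq_zero 2 hi hj) x

/-- X_i(h_j) = ⟨(R*)^i dh_j, X₀⟩ = X₀(h_{i+j}), and h_{i+j} is homogeneous of degree i + j along X₀.
-/
theorem deriv_X_apply (i : ℕ) {j : ℕ} (hj : 1 ≤ j) (x : Phase N) :
    deriv (X N i) (h j) x = ((i : ℝ) + j) * h (i + j) x := by
  rw [deriv, fderiv_eq_grad_dotProduct, X_eq, dotProduct_recOp_pow, ← hh.grad_add i hj,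
    ← fderiv_eq_grad_dotProduct]
  have := hh.euler (i + j) (by omega) x
  rw [deriv] at this
  rw [this]
  push_cast
  rfl

/-- The factor j is (i + j) - i: the first term from X_i(h_j), the second from the Lie derivative of
J₂ along X_i. -/
theorem lieBracket_X_flow (i : ℕ) {j : ℕ} (hj : 1 ≤ j) (x : Phase N) :
    VectorField.lieBracket ℝ (X N i) (flow N j) x = (j : ℝ) • flow N (i + j) x := by
  funext a
  rw [hh.flow_eq_canonOp hj, lieBracket_hamiltonian (J := J N 2) (J_mulVec 2) (contDiff_X i)
    (hh.contDiff j hj)]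
  have hd : (fun y => X N i y a) = deriv (X N i) (fun y => y a) := by
    funext y
    rw [deriv, fderiv_eq_grad_dotProduct, grad_proj, single_one_dotProduct]
  have h1 := deriv_bracket_J i le_rfl (f := fun y : Phase N => y a) (contDiff_apply ℝ ℝ a)
    (hh.contDiff j hj) x
  have h2 : deriv (X N i) (h j) = fun x => ((i : ℝ) + j) * h (i + j) x :=
    funext (hh.deriv_X_apply i hj)
  rw [hd]
  rw [h2, bracket_eq_dotProduct _ _ (fun x => ((i : ℝ) + j) * h (i + j) x),
    grad_const_mul _ ((hh.contDiff (i + j) (by omega)).differentiable (by simp) x),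
    bracket_eq_dotProduct (J N (i + 2)), Matrix.mulVec_smul, J_mulVec, J_mulVec, tensorOp_apply,
    tensorOp_apply, hh.recOp_pow_canonOp_grad _ (by omega), hh.recOp_pow_canonOp_grad _ hj,
    grad_proj] at h1
  simp only [single_one_dotProduct, Pi.smul_apply, smul_eq_mul, Nat.sub_self, zero_add,
    Nat.add_sub_cancel, Nat.cast_ofNat] at h1 ⊢
  linarith

theorem isMasterSymmetryOn (i : ℕ) {j : ℕ} (hj : 1 ≤ j) (hne : ∃ x, flow N (i + j) x ≠ 0) :
    IsMasterSymmetryOn Set.univ (X N i) (flow N j) := by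
  have h1 : VectorField.lieBracket ℝ (X N i) (flow N j) = (j : ℝ) • flow N (i + j) :=
    funext (hh.lieBracket_X_flow i hj)
  have hj0 : (j : ℝ) ≠ 0 := by positivity
  refine ⟨fun x _ => ?_, ?_⟩
  · rw [h1, VectorField.lieBracket_const_smul_left
      ((hh.contDiff_flow (by omega)).differentiable (by simp) x),
      hh.lieBracket_flow (by omega) hj, smul_zero]
  · obtain ⟨x, hx⟩ := hne
    refine ⟨x, Set.mem_univ x, ?_⟩
    rw [h1]
    exact smul_ne_zero hj0 hx

end IsLenardSequence

/-! ### Jacobi matrices -/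

/-- The Jacobi matrix with zero diagonal and off-diagonal entries `τ 1, …, τ N`. -/
noncomputable def jacobiMatrix (N : ℕ) (τ : ℕ → ℝ) : Matrix (Fin (N + 1)) (Fin (N + 1)) ℝ :=
  Matrix.of fun a b => (if (b : ℕ) = a + 1 then τ (a + 1) else 0)
    + (if (b : ℕ) + 1 = a then τ a else 0)

/-- The entries of a matrix indexed by natural numbers, zero outside of the range. -/
noncomputable def ent (M : Matrix (Fin (N + 1)) (Fin (N + 1)) ℝ) (a b : ℕ) : ℝ :=
  if h : a < N + 1 ∧ b < N + 1 then M ⟨a, h.1⟩ ⟨b, h.2⟩ else 0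

theorem ent_fin (M : Matrix (Fin (N + 1)) (Fin (N + 1)) ℝ) (a b : Fin (N + 1)) :
    ent M a b = M a b := by
  rw [ent, dif_pos ⟨a.2, b.2⟩]

theorem ent_symm {M : Matrix (Fin (N + 1)) (Fin (N + 1)) ℝ} (hM : M.transpose = M) (a b : ℕ) :
    ent M a b = ent M b a := by
  unfold ent
  split_ifs with h1 h2 h2
  · exact congrFun₂ hM ⟨b, h1.2⟩ ⟨a, h1.1⟩
  · exact absurd h1.symm h2
  · exact absurd h2.symm h1
  · rfl

theorem jacobiMatrix_transpose (τ : ℕ → ℝ) : (jacobiMatrix N τ).transpose = jacobiMatrix N τ := by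
  ext a b
  simp only [jacobiMatrix, Matrix.transpose_apply, Matrix.of_apply]
  grind

theorem jacobiMatrix_pow_transpose (τ : ℕ → ℝ) (m : ℕ) :
    (jacobiMatrix N τ ^ m).transpose = jacobiMatrix N τ ^ m := by
  rw [Matrix.transpose_pow, jacobiMatrix_transpose]

/-- The three-term recurrence holds at both ends: at a = 0 the truncated index a - 1 is killed by
`h0`, and at a = N the out-of-range entry is zero by definition of `ent`. -/
theorem ent_jacobiMatrix_mul (τ : ℕ → ℝ) (h0 : τ 0 = 0)
    (M : Matrix (Fin (N + 1)) (Fin (N + 1)) ℝ) {a : ℕ} (ha : a ≤ N) (b : ℕ) :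
    ent (jacobiMatrix N τ * M) a b = τ a * ent M (a - 1) b + τ (a + 1) * ent M (a + 1) b := by
  by_cases hb : b < N + 1
  swap
  · simp [ent, hb]
  have h1 : ∀ (m : ℕ), ∑ c : Fin (N + 1), (if (c : ℕ) = m then 1 else 0) * M c ⟨b, hb⟩
      = ent M m b := by
    intro m
    by_cases hm : m < N + 1
    · rw [Finset.sum_eq_single ⟨m, hm⟩]
      · simp [ent, hm, hb]
      · intro c _ hc
        rw [if_neg fun h => hc (Fin.ext h), zero_mul]
      · simp
    · rw [ent, dif_neg (by tauto)]
      refine Finset.sum_eq_zero fun c _ => ?_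
      rw [if_neg (by omega), zero_mul]
  rw [ent, dif_pos ⟨by omega, hb⟩, Matrix.mul_apply, ← h1, ← h1, Finset.mul_sum, Finset.mul_sum,
    ← Finset.sum_add_distrib]
  refine Finset.sum_congr rfl fun c _ => ?_
  simp only [jacobiMatrix, Matrix.of_apply]
  rcases a with _ | a
  · simp [h0]
  · simp only [Nat.add_sub_cancel, add_left_inj]
    split_ifs <;> ring

theorem trace_jacobiMatrix_mul (τ : ℕ → ℝ) (h0 : τ 0 = 0) (hN : τ (N + 1) = 0)
    {M : Matrix (Fin (N + 1)) (Fin (N + 1)) ℝ} (hM : M.transpose = M) :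
    (jacobiMatrix N τ * M).trace = 2 * ∑ k ∈ Finset.range N, τ (k + 1) * ent M k (k + 1) := by
  have h1 : (jacobiMatrix N τ * M).trace
      = ∑ a ∈ Finset.range (N + 1), ent (jacobiMatrix N τ * M) a a := by
    rw [← Fin.sum_univ_eq_sum_range (fun a => ent (jacobiMatrix N τ * M) a a)]
    simp only [ent_fin]
    rfl
  have h2 : ∀ a ∈ Finset.range (N + 1), ent (jacobiMatrix N τ * M) a a
      = τ a * ent M (a - 1) a + τ (a + 1) * ent M (a + 1) a := fun a ha =>
    ent_jacobiMatrix_mul τ h0 M (by simpa [Nat.lt_succ_iff] using ha) a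
  rw [h1, Finset.sum_congr rfl h2, Finset.sum_add_distrib, Finset.sum_range_succ', h0, zero_mul,
    add_zero, Finset.sum_range_succ _ N, hN, zero_mul, add_zero, two_mul]
  congr 1
  exact Finset.sum_congr rfl fun k _ => by rw [ent_symm hM (k + 1) k]

/-- The Lenard relation in terms of the entries of the even and odd powers of a Jacobi matrix. -/
theorem sum_jacobiMatrix_lenard (τ X : ℕ → ℝ) (h0 : τ 0 = 0) (hN : τ (N + 1) = 0) (m : ℕ) :
    ∑ k ∈ Finset.range N, (X k - X (k + 1)) * (τ (k + 1) * ent (jacobiMatrix N τ ^ (m + 1)) k (k + 1))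
      = ∑ k ∈ Finset.range N, τ (k + 1) ^ 2 * (X k * ent (jacobiMatrix N τ ^ m) (k + 1) (k + 1)
          - X (k + 1) * ent (jacobiMatrix N τ ^ m) k k) := by
  set P := jacobiMatrix N τ ^ m with hP
  have hs : P.transpose = P := jacobiMatrix_pow_transpose τ m
  -- Expanding the same entry along row k (`e1`) and along row k + 1 (`e2`) leaves the remainders
  -- c_k and c_{k+1}. Weighted by X k and X (k + 1) they telescope, and τ 0 = τ (N + 1) = 0 removes
  -- the boundary.
  set c : ℕ → ℝ := fun k => τ k * τ (k + 1) * ent P (k - 1) (k + 1) with hc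
  have e1 : ∀ k < N, τ (k + 1) * ent (jacobiMatrix N τ ^ (m + 1)) k (k + 1)
      = c k + τ (k + 1) ^ 2 * ent P (k + 1) (k + 1) := by
    intro k hk
    rw [pow_succ', ent_jacobiMatrix_mul τ h0 _ hk.le]
    simp only [hc, ← hP]; ring
  have e2 : ∀ k < N, τ (k + 1) * ent (jacobiMatrix N τ ^ (m + 1)) k (k + 1)
      = c (k + 1) + τ (k + 1) ^ 2 * ent P k k := by
    intro k hk
    rw [ent_symm (jacobiMatrix_pow_transpose τ _), pow_succ', ent_jacobiMatrix_mul τ h0 _ (by omega : k + 1 ≤ N),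
      ← hP, ent_symm hs (k + 1 + 1) k]
    simp only [hc, Nat.add_sub_cancel]; ring
  have e3 : ∀ k ∈ Finset.range N,
      (X k - X (k + 1)) * (τ (k + 1) * ent (jacobiMatrix N τ ^ (m + 1)) k (k + 1))
      = τ (k + 1) ^ 2 * (X k * ent P (k + 1) (k + 1) - X (k + 1) * ent P k k)
        + (c k * X k - c (k + 1) * X (k + 1)) := by
    intro k hk
    have hk := Finset.mem_range.1 hk
    rw [sub_mul, e1 k hk]
    nth_rewrite 2 [← e1 k hk]
    rw [e2 k hk]
    ring
  rw [Finset.sum_congr rfl e3, Finset.sum_add_distrib, Finset.sum_range_sub']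
  simp [hc, h0, hN]

/-! ### Derivatives of traces of powers -/

section TracePow

variable {n : Type*} [Fintype n] [DecidableEq n]

/-- The derivative of the `m`-th power of a matrix `A` in the direction `A'`. -/
noncomputable def powDeriv (A A' : Matrix n n ℝ) : ℕ → Matrix n n ℝ
  | 0 => 0
  | m + 1 => A' * A ^ m + A * powDeriv A A' m

theorem hasDerivAt_matrix_pow {A : ℝ → Matrix n n ℝ} {A' : Matrix n n ℝ} {t : ℝ}
    (hA : ∀ a b, HasDerivAt (fun t => A t a b) (A' a b) t) (m : ℕ) (a b : n) :
    HasDerivAt (fun t => (A t ^ m) a b) (powDeriv (A t) A' m a b) t := by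
  induction m generalizing a b with
  | zero => simpa [powDeriv] using hasDerivAt_const t ((1 : Matrix n n ℝ) a b)
  | succ m ih =>
    simp only [pow_succ', powDeriv, Matrix.mul_apply, Matrix.add_apply, ← Finset.sum_add_distrib]
    exact HasDerivAt.fun_sum fun c _ => (hA a c).mul (ih c b)

/-- The extra factor `B` commuting with `A` is what lets the induction close: the step absorbs one
`A` into `B` and uses cyclicity of the trace. -/
theorem trace_mul_powDeriv (A A' B : Matrix n n ℝ) (hB : Commute B A) (m : ℕ) :
    (B * powDeriv A A' (m + 1)).trace = (m + 1) * (B * A ^ m * A').trace := by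
  induction m generalizing B with
  | zero => simp [powDeriv]
  | succ m ih =>
    rw [powDeriv, mul_add, Matrix.trace_add, ← mul_assoc B A, ih _ (hB.mul_left (Commute.refl A)),
      ← mul_assoc, Matrix.trace_mul_comm (B * A'), ← mul_assoc, ← (hB.pow_right (m + 1)).eq,
      mul_assoc B A, ← pow_succ']
    push_cast
    ring

theorem hasDerivAt_trace_pow {A : ℝ → Matrix n n ℝ} {A' : Matrix n n ℝ} {t : ℝ}
    (hA : ∀ a b, HasDerivAt (fun t => A t a b) (A' a b) t) (m : ℕ) :
    HasDerivAt (fun t => (A t ^ (m + 1)).trace) ((m + 1) * (A t ^ m * A').trace) t := by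
  have h := trace_mul_powDeriv (A t) A' 1 (Commute.one_left _) m
  rw [one_mul, one_mul] at h
  rw [← h]
  exact HasDerivAt.fun_sum fun a _ => hasDerivAt_matrix_pow hA (m + 1) a a

theorem pow_entries_nonneg {A : Matrix n n ℝ} (h0 : ∀ a b, 0 ≤ A a b) (m : ℕ) (a b : n) :
    0 ≤ (A ^ m) a b := by
  induction m generalizing a b with
  | zero => rw [pow_zero, Matrix.one_apply]; split_ifs <;> simp
  | succ m ih =>
    rw [pow_succ', Matrix.mul_apply]
    exact Finset.sum_nonneg fun c _ => mul_nonneg (h0 a c) (ih c b)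

theorem pow_diag_pos {A : Matrix n n ℝ} (h0 : ∀ a b, 0 ≤ A a b) (h1 : ∀ a, 0 < A a a) (m : ℕ)
    (a : n) : 0 < (A ^ m) a a := by
  induction m with
  | zero => simp
  | succ m ih =>
    rw [pow_succ', Matrix.mul_apply]
    exact Finset.sum_pos' (fun c _ => mul_nonneg (h0 a c) (pow_entries_nonneg h0 m c a))
      ⟨a, Finset.mem_univ a, mul_pos (h1 a) ih⟩

end TracePow

/-! ### The Lax matrix -/

/-- The off-diagonal entries of the square root of the Lax matrix. -/
noncomputable def sqrtCoord (w : Fin N → ℝ) (k : ℕ) : ℝ := √(coord w k)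

theorem coord_nonneg {w : Fin N → ℝ} (hw : w ∈ orthant N) (k : ℕ) : 0 ≤ coord w k := by
  unfold coord; split_ifs
  · exact (hw _).le
  · exact le_rfl

theorem coord_pos {w : Fin N → ℝ} (hw : w ∈ orthant N) {k : ℕ} (h1 : 1 ≤ k) (h2 : k ≤ N) :
    0 < coord w k := by
  rw [coord_of_mem h1 h2]; exact hw _

theorem sqrtCoord_sq {w : Fin N → ℝ} (hw : w ∈ orthant N) (k : ℕ) :
    sqrtCoord w k ^ 2 = coord w k := Real.sq_sqrt (coord_nonneg hw k)

theorem sqrtCoord_zero (w : Fin N → ℝ) : sqrtCoord w 0 = 0 := by simp [sqrtCoord, coord]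

theorem sqrtCoord_last (w : Fin N → ℝ) : sqrtCoord w (N + 1) = 0 := by simp [sqrtCoord, coord]

theorem ent_jacobiMatrix (τ : ℕ → ℝ) {a b : ℕ} (ha : a ≤ N) (hb : b ≤ N) :
    ent (jacobiMatrix N τ) a b = (if b = a + 1 then τ (a + 1) else 0)
      + (if b + 1 = a then τ a else 0) := by
  rw [ent, dif_pos ⟨by omega, by omega⟩]
  rfl

/-- Entries of the square count two-step walks on a path with edge weights √u_k: returning gives u_a
+ u_{a+1}, advancing gives √(u_k u_{k+1}). -/
theorem lax_eq_sq {w : Fin N → ℝ} (hw : w ∈ orthant N) :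
    lax w = jacobiMatrix N (sqrtCoord w) ^ 2 := by
  ext ⟨a, ha⟩ ⟨b, hb⟩
  have hs := sqrtCoord_sq hw
  have hsq : ∀ i j, √(coord w i * coord w j) = sqrtCoord w i * sqrtCoord w j :=
    fun i j => Real.sqrt_mul (coord_nonneg hw _) _
  have h0 := sqrtCoord_zero w
  have hN := sqrtCoord_last w
  rw [← ent_fin (jacobiMatrix N (sqrtCoord w) ^ 2), sq,
    ent_jacobiMatrix_mul _ (sqrtCoord_zero w) _ (by simp; omega)]
  simp only [lax, Matrix.of_apply, Fin.mk.injEq, ← hs]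
  rw [ent_jacobiMatrix _ (by omega) (by omega)]
  have h2 : sqrtCoord w (a + 1) * ent (jacobiMatrix N (sqrtCoord w)) (a + 1) b
      = sqrtCoord w (a + 1) * ((if b = a + 2 then sqrtCoord w (a + 2) else 0)
      + (if b = a then sqrtCoord w (a + 1) else 0)) := by
    by_cases h : a + 1 ≤ N
    · rw [ent_jacobiMatrix _ h (by omega)]
      simp
    · obtain rfl : a = N := by omega
      rw [hN]; ring
  rw [h2]
  rcases a with _ | a
  · simp only [h0]
    grind
  · simp only [Nat.add_sub_cancel]
    grind

theorem H_eq_trace {w : Fin N → ℝ} (hw : w ∈ orthant N) (j : ℕ) :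
    H j w = (1 / (j : ℝ)) * (jacobiMatrix N (sqrtCoord w) ^ (2 * j)).trace := by
  rw [H, lax_eq_sq hw, pow_mul]

theorem lax_nonneg {w : Fin N → ℝ} (hw : w ∈ orthant N) (a b : Fin (N + 1)) : 0 ≤ lax w a b := by
  simp only [lax, Matrix.of_apply]
  have := coord_nonneg hw
  split_ifs
  · exact add_nonneg (this _) (this _)
  all_goals first | exact Real.sqrt_nonneg _ | exact le_rfl

theorem lax_diag_pos (hN : 1 ≤ N) {w : Fin N → ℝ} (hw : w ∈ orthant N) (a : Fin (N + 1)) :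
    0 < lax w a a := by
  simp only [lax, Matrix.of_apply, if_true]
  have := coord_nonneg hw
  by_cases h : (a : ℕ) = 0
  · exact add_pos_of_nonneg_of_pos (this _) (coord_pos hw (by omega) (by omega))
  · exact add_pos_of_pos_of_nonneg (coord_pos hw (by omega) (by omega)) (this _)

theorem H_pos (hN : 1 ≤ N) {w : Fin N → ℝ} (hw : w ∈ orthant N) {j : ℕ} (hj : 1 ≤ j) :
    0 < H j w := by
  refine mul_pos (by positivity) (Finset.sum_pos (fun a _ => ?_) Finset.univ_nonempty)
  exact pow_diag_pos (lax_nonneg hw) (lax_diag_pos hN hw) j a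

/-- One step along the edge from 1 to 2, followed by a positive diagonal entry of a power of the Lax
matrix, bounds the entry from below. It serves to show ∂H_j/∂u_2 > 0. -/
theorem ent_sqrt_lax_pos (hN : 2 ≤ N) {w : Fin N → ℝ} (hw : w ∈ orthant N) (m : ℕ) :
    0 < ent (jacobiMatrix N (sqrtCoord w) ^ (2 * m + 1)) 1 2 := by
  rw [pow_succ', pow_mul, ← lax_eq_sq hw,
    ent_jacobiMatrix_mul _ (sqrtCoord_zero w) _ (by omega)]
  refine add_pos_of_nonneg_of_pos (mul_nonneg (Real.sqrt_nonneg _) ?_)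
    (mul_pos (Real.sqrt_pos.2 (coord_pos hw (by omega) (by omega))) ?_)
  · rw [ent]
    split_ifs
    · exact pow_entries_nonneg (lax_nonneg hw) _ _ _
    · exact le_rfl
  · rw [ent, dif_pos ⟨by omega, by omega⟩]
    exact pow_diag_pos (lax_nonneg hw) (lax_diag_pos (by omega) hw) m _

theorem contDiff_coord (k : ℕ) : ContDiff ℝ ∞ (fun w : Fin N → ℝ => coord w k) := by
  unfold coord
  split_ifs
  · exact contDiff_apply ℝ ℝ _
  · exact contDiff_const

theorem contDiffOn_lax (a b : Fin (N + 1)) :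
    ContDiffOn ℝ ∞ (fun w : Fin N → ℝ => lax w a b) (orthant N) := by
  simp only [lax, Matrix.of_apply]
  have h : ∀ i j, ContDiffOn ℝ ∞ (fun w : Fin N → ℝ => coord w i * coord w j) (orthant N) :=
    fun i j => ((contDiff_coord i).mul (contDiff_coord j)).contDiffOn
  split_ifs with h1 h2 h3
  · exact ((contDiff_coord _).add (contDiff_coord _)).contDiffOn
  · exact (h _ _).sqrt fun w hw => (mul_pos (coord_pos hw (by omega) (by omega))
      (coord_pos hw (by omega) (by omega))).ne'
  · exact (h _ _).sqrt fun w hw => (mul_pos (coord_pos hw (by omega) (by omega))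
      (coord_pos hw (by omega) (by omega))).ne'
  · exact contDiffOn_const

theorem contDiffOn_H (j : ℕ) : ContDiffOn ℝ ∞ (H (N := N) j) (orthant N) := by
  have h : ∀ m a b, ContDiffOn ℝ ∞ (fun w : Fin N → ℝ => (lax w ^ m) a b) (orthant N) := by
    intro m
    induction m with
    | zero => intro a b; simpa using contDiffOn_const
    | succ m ih =>
      intro a b
      simp only [pow_succ', Matrix.mul_apply]
      exact ContDiffOn.sum fun c _ => (contDiffOn_lax a c).mul (ih c b)
  unfold H
  exact contDiffOn_const.mul (ContDiffOn.sum fun a _ => h j a a)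

/-! ### The Volterra map -/

/-- The differential of `log u_{k+1}`. -/
noncomputable def linkForm (N k : ℕ) : Phase N →L[ℝ] ℝ :=
  sympl N (chainVec N k) - sympl N (chainVec N (k + 1))

theorem linkForm_apply (k : ℕ) (x : Phase N) :
    linkForm N k x = p x (k + 1) + (1 / 2) * (q x (k + 2) - q x k) :=
  sympl_chainVec_sub k x

theorem volterraMap_apply (x : Phase N) (a : Fin N) :
    volterraMap N x a = Real.exp (linkForm N a x) := by
  rw [volterraMap, linkForm_apply]

theorem volterraMap_mem (x : Phase N) : volterraMap N x ∈ orthant N := fun a => by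
  rw [volterraMap_apply]; exact Real.exp_pos _

theorem hasFDerivAt_volterraMap (x : Phase N) :
    HasFDerivAt (volterraMap N)
      (ContinuousLinearMap.pi fun a : Fin N => volterraMap N x a • linkForm N a) x := by
  refine hasFDerivAt_pi.2 fun a => ?_
  have h : (fun x => volterraMap N x a) = fun x => Real.exp (linkForm N a x) :=
    funext fun x => volterraMap_apply x a
  rw [h, volterraMap_apply]
  exact (linkForm N a).hasFDerivAt.exp

theorem fderiv_volterraMap (x v : Phase N) (a : Fin N) :
    fderiv ℝ (volterraMap N) x v a = volterraMap N x a * linkForm N a v := by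
  rw [(hasFDerivAt_volterraMap x).fderiv]
  simp

theorem contDiff_volterraMap : ContDiff ℝ ∞ (volterraMap N) := by
  refine contDiff_pi.2 fun a => ?_
  simp only [volterraMap_apply]
  fun_prop

/-- On phase space √u_k = exp(½ log u_k), so differentiating it only multiplies by half a linear
form. Outside 1 ≤ k ≤ N both sides are zero, whatever `k - 1` truncates to. -/
theorem hasDerivAt_sqrtCoord (x v : Phase N) (k : ℕ) :
    HasDerivAt (fun t : ℝ => sqrtCoord (volterraMap N (x + t • v)) k)
      (1 / 2 * linkForm N (k - 1) v * sqrtCoord (volterraMap N x) k) 0 := by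
  by_cases hk : 1 ≤ k ∧ k ≤ N
  · have h : ∀ y, sqrtCoord (volterraMap N y) k = Real.exp (linkForm N (k - 1) y / 2) := by
      intro y
      rw [sqrtCoord, coord_of_mem hk.1 hk.2, volterraMap_apply, Real.exp_half]
    simp only [h, map_add, map_smul, smul_eq_mul]
    have h1 : HasDerivAt (fun t : ℝ => (linkForm N (k - 1) x + t * linkForm N (k - 1) v) / 2)
        (1 * linkForm N (k - 1) v / 2) 0 :=
      (((hasDerivAt_id (0 : ℝ)).mul_const _).const_add _).div_const 2
    convert h1.exp using 1
    simp
    ring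
  · have h : ∀ y, sqrtCoord (volterraMap N y) k = 0 := by
      intro y
      rw [sqrtCoord, coord_of_not_mem hk, Real.sqrt_zero]
    simp only [h, mul_zero]
    exact hasDerivAt_const _ _

/-! ### The Hamiltonians on phase space -/

/-- The Hamiltonians `h_j = (1/2) H_j ∘ Ψ`. -/
noncomputable def ham (N j : ℕ) (x : Phase N) : ℝ := 1 / 2 * H j (volterraMap N x)

/-- The square root of the Lax matrix, as a function on phase space. -/
noncomputable def sqrtLax (x : Phase N) : Matrix (Fin (N + 1)) (Fin (N + 1)) ℝ :=
  jacobiMatrix N (sqrtCoord (volterraMap N x))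

theorem sqrtLax_pow_transpose (x : Phase N) (m : ℕ) :
    (sqrtLax x ^ m).transpose = sqrtLax x ^ m := jacobiMatrix_pow_transpose _ m

theorem contDiff_ham (j : ℕ) : ContDiff ℝ ∞ (ham N j) :=
  contDiff_const.mul ((contDiffOn_H j).comp_contDiff contDiff_volterraMap volterraMap_mem)

theorem ham_eq_trace (j : ℕ) (x : Phase N) :
    ham N j x = 1 / (2 * j) * (sqrtLax x ^ (2 * j)).trace := by
  rw [ham, H_eq_trace (volterraMap_mem x), sqrtLax]
  ring

theorem fderiv_ham_trace {j : ℕ} (hj : 1 ≤ j) (x v : Phase N) :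
    fderiv ℝ (ham N j) x v = (jacobiMatrix N (fun k => 1 / 2 * linkForm N (k - 1) v *
      sqrtCoord (volterraMap N x) k) * sqrtLax x ^ (2 * j - 1)).trace := by
  have h1 : HasDerivAt (fun t : ℝ => ham N j (x + t • v)) (fderiv ℝ (ham N j) x v) 0 := by
    have hl : HasDerivAt (fun t : ℝ => x + t • v) v 0 := by
      simpa using ((hasDerivAt_id (0 : ℝ)).smul_const v).const_add x
    have hf : HasFDerivAt (ham N j) (fderiv ℝ (ham N j) x) (x + (0 : ℝ) • v) := by
      rw [zero_smul, add_zero]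
      exact ((contDiff_ham j).differentiable (by simp) x).hasFDerivAt
    exact hf.comp_hasDerivAt 0 hl
  have h2 : ∀ a b, HasDerivAt (fun t : ℝ => sqrtLax (x + t • v) a b)
      (jacobiMatrix N (fun k => 1 / 2 * linkForm N (k - 1) v *
        sqrtCoord (volterraMap N x) k) a b) 0 := by
    intro a b
    simp only [sqrtLax, jacobiMatrix, Matrix.of_apply]
    refine HasDerivAt.add ?_ ?_
    · split_ifs
      · exact hasDerivAt_sqrtCoord x v _
      · exact hasDerivAt_const _ _
    · split_ifs
      · exact hasDerivAt_sqrtCoord x v _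
      · exact hasDerivAt_const _ _
  have h3 := (hasDerivAt_trace_pow h2 (2 * j - 1)).const_mul (1 / (2 * (j : ℝ)))
  rw [Nat.sub_add_cancel (by omega)] at h3
  simp only [← ham_eq_trace, zero_smul, add_zero] at h3
  rw [h1.unique h3, Matrix.trace_mul_comm, Nat.cast_sub (by omega)]
  push_cast
  field_simp
  ring

/-- The factor 1/2 from the square roots cancels the 2 by which the trace counts each edge in both
directions. -/
theorem fderiv_ham {j : ℕ} (hj : 1 ≤ j) (x v : Phase N) :
    fderiv ℝ (ham N j) x v = ∑ k ∈ Finset.range N, linkForm N k v *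
      (sqrtCoord (volterraMap N x) (k + 1) * ent (sqrtLax x ^ (2 * j - 1)) k (k + 1)) := by
  rw [fderiv_ham_trace hj, trace_jacobiMatrix_mul _ (by simp [sqrtCoord_zero])
    (by simp [sqrtCoord_last]) (sqrtLax_pow_transpose _ _), Finset.mul_sum]
  refine Finset.sum_congr rfl fun k _ => ?_
  rw [Nat.add_sub_cancel]
  ring

theorem fderiv_ham_X₀ {j : ℕ} (hj : 1 ≤ j) (x : Phase N) :
    fderiv ℝ (ham N j) x (X₀ N x) = j * ham N j x := by
  have h1 : (sqrtLax x ^ (2 * j)).trace = 2 * ∑ k ∈ Finset.range N,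
      (sqrtCoord (volterraMap N x) (k + 1) * ent (sqrtLax x ^ (2 * j - 1)) k (k + 1)) := by
    obtain ⟨m, hm⟩ : ∃ m, 2 * j = m + 1 := ⟨2 * j - 1, by omega⟩
    rw [hm, pow_succ']
    exact trace_jacobiMatrix_mul _ (sqrtCoord_zero _) (sqrtCoord_last _)
      (sqrtLax_pow_transpose _ _)
  rw [fderiv_ham hj, ham_eq_trace, h1]
  have h2 : ∀ k ∈ Finset.range N, linkForm N k (X₀ N x) *
      (sqrtCoord (volterraMap N x) (k + 1) * ent (sqrtLax x ^ (2 * j - 1)) k (k + 1))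
      = sqrtCoord (volterraMap N x) (k + 1) * ent (sqrtLax x ^ (2 * j - 1)) k (k + 1) := by
    intro k hk
    rw [linkForm, sub_apply, sympl_X₀ (Finset.mem_range.1 hk), one_mul]
  rw [Finset.sum_congr rfl h2]
  have : (j : ℝ) ≠ 0 := by positivity
  field_simp

/-- By the constant pairings, b_m changes log u_{k+1} only if it is an end of link k, and then at
rate -1: an incidence matrix up to sign. -/
theorem linkForm_chainVec {k m : ℕ} (hk : k < N) (hm : m ≤ N) :
    linkForm N k (chainVec N m) = -((if m = k then 1 else 0) + (if m = k + 1 then 1 else 0)) := by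
  rw [linkForm, sub_apply]
  rcases lt_trichotomy k m with h | rfl | h
  · rw [sympl_chainVec_lt hm h, if_neg h.ne']
    rcases (Nat.succ_le_of_lt h).eq_or_lt with rfl | h
    · simp [sympl_chainVec_self]
    · rw [sympl_chainVec_lt hm h, if_neg (by simpa using h.ne')]
      ring
  · rw [sympl_chainVec_self, sympl_chainVec_gt hk (Nat.lt_succ_self _)]
    simp
  · rw [sympl_chainVec_gt hk.le h, sympl_chainVec_gt hk (by omega), if_neg h.ne, if_neg (by omega)]
    ring

/-- Only the two edges at vertex m contribute, and their sum is the three-term recurrence for the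
diagonal entry of the next power. -/
theorem fderiv_ham_chainVec {j : ℕ} (hj : 1 ≤ j) (x : Phase N) {m : ℕ} (hm : m ≤ N) :
    fderiv ℝ (ham N j) x (chainVec N m) = -ent (sqrtLax x ^ (2 * j)) m m := by
  set f : ℕ → ℝ := fun k =>
    sqrtCoord (volterraMap N x) (k + 1) * ent (sqrtLax x ^ (2 * j - 1)) k (k + 1) with hf
  have h1 : ∀ k ∈ Finset.range N, linkForm N k (chainVec N m) * f k
      = -((if m = k then f k else 0) + (if m = k + 1 then f (m - 1) else 0)) := by
    intro k hk
    rw [linkForm_chainVec (Finset.mem_range.1 hk) hm]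
    split_ifs with h1 h2 h2
    · omega
    · simp
    · subst h2; simp
    · simp
  have h2 : ∑ k ∈ Finset.range N, (if m = k + 1 then f (m - 1) else 0)
      = if m = 0 then 0 else f (m - 1) := by
    rcases m with _ | m
    · simp
    · simp only [add_left_inj, Nat.add_sub_cancel, Finset.sum_ite_eq, Finset.mem_range]
      rw [if_pos (by omega), if_neg (by omega)]
  rw [fderiv_ham hj, Finset.sum_congr rfl h1, Finset.sum_neg_distrib, Finset.sum_add_distrib, h2,
    Finset.sum_ite_eq, neg_inj]
  obtain ⟨l, hl⟩ : ∃ l, 2 * j = l + 1 := ⟨2 * j - 1, by omega⟩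
  have h3 : ent (sqrtLax x ^ (l + 1)) m m = sqrtCoord (volterraMap N x) m
      * ent (sqrtLax x ^ l) (m - 1) m
      + sqrtCoord (volterraMap N x) (m + 1) * ent (sqrtLax x ^ l) (m + 1) m := by
    rw [pow_succ']
    exact ent_jacobiMatrix_mul _ (sqrtCoord_zero _) _ hm _
  rw [hl, h3, ent_symm (sqrtLax_pow_transpose _ _) (m + 1) m, add_comm]
  simp only [hf, hl, Nat.add_sub_cancel]
  congr 1
  · split_ifs with h
    · rw [h, sqrtCoord_zero, zero_mul]
    · rw [Nat.sub_add_cancel (by omega)]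
  · simp only [Finset.mem_range]
    split_ifs with h
    · rfl
    · obtain rfl : m = N := by omega
      rw [sqrtCoord_last, zero_mul]

/-- The Lenard recursion for the Hamiltonians. -/
theorem fderiv_ham_succ {j : ℕ} (hj : 1 ≤ j) (x v : Phase N) :
    fderiv ℝ (ham N (j + 1)) x v = fderiv ℝ (ham N j) x (recOp N x v) := by
  rw [recOp, Nijenhuis.chainOp_apply, map_sum, fderiv_ham (by omega)]
  have e : 2 * (j + 1) - 1 = 2 * j + 1 := by omega
  rw [e]
  -- The free sequence is X k = σ(b_k, v), whose differences are the link forms; the right side is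
  -- then dh_j along R v, by its values on the chain vectors.
  refine (sum_jacobiMatrix_lenard (sqrtCoord (volterraMap N x))
    (fun k => sympl N (chainVec N k) v) (sqrtCoord_zero _) (sqrtCoord_last _) (2 * j)).trans ?_
  refine Finset.sum_congr rfl fun k hk => ?_
  have hk := Finset.mem_range.1 hk
  rw [sqrtCoord_sq (volterraMap_mem x), ← u, u_succ_eq_exp hk, map_smul,
    Nijenhuis.chainTerm_apply, map_sub, map_smul, map_smul, fderiv_ham_chainVec hj x hk.le,
    fderiv_ham_chainVec hj x hk]
  simp only [smul_eq_mul, sqrtLax]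
  ring

theorem ham_one : ham N 1 = h₁ N := by
  funext x
  have h1 : (lax (volterraMap N x)).trace
      = ∑ a ∈ Finset.range (N + 1), (u x a + u x (a + 1)) := by
    rw [← Fin.sum_univ_eq_sum_range (fun a => u x a + u x (a + 1))]
    refine Finset.sum_congr rfl fun a _ => ?_
    simp [lax, u]
  have h2 : ∑ a ∈ Finset.range N, u x (a + 1) = h₁ N x := by
    rw [← Fin.sum_univ_eq_sum_range (fun a => u x (a + 1))]
    exact Finset.sum_congr rfl fun a _ => coord_succ _ _
  have h3 : u x 0 = 0 := coord_of_not_mem (by omega)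
  have h4 : u x (N + 1) = 0 := coord_of_not_mem (by omega)
  rw [ham, H, pow_one, h1, Finset.sum_add_distrib, Finset.sum_range_succ', h3,
    Finset.sum_range_succ _ N, h4, h2]
  push_cast
  ring

theorem isLenardSequence_ham : IsLenardSequence (ham N) where
  contDiff j _ := contDiff_ham j
  one := ham_one
  grad_succ j hj x := by
    refine dotProduct_eq _ _ fun v => ?_
    rw [← fderiv_eq_grad_dotProduct, fderiv_ham_succ hj, fderiv_eq_grad_dotProduct]
    simpa using dotProduct_recOp_pow 1 x (grad (ham N j) x) v
  euler j hj x := fderiv_ham_X₀ hj x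

/-- A zero of the flow would be a critical point of h_j, whereas X₀(h_j) = j h_j > 0 everywhere. -/
theorem flow_ne_zero (hN : 1 ≤ N) {j : ℕ} (hj : 1 ≤ j) (x : Phase N) : flow N j x ≠ 0 := by
  intro h
  have h1 := fderiv_ham_X₀ hj x
  rw [fderiv_eq_grad_dotProduct, dotProduct_eq_sympl_canonOp, isLenardSequence_ham.canonOp_grad hj,
    h, map_zero, zero_apply, neg_zero] at h1
  have h2 : 0 < (j : ℝ) * (1 / 2 * H j (volterraMap N x)) := by
    have := H_pos hN (volterraMap_mem x) hj
    positivity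
  exact h2.ne h1

/-! ### Projection of the hierarchy through the Volterra map -/

/-- The section `q = 0`, `p = log w` of the Volterra map. -/
noncomputable def volterraSection (w : Fin N → ℝ) : Phase N :=
  Sum.elim 0 (fun i => Real.log (w i))

theorem volterraMap_section {w : Fin N → ℝ} (hw : w ∈ orthant N) :
    volterraMap N (volterraSection w) = w := by
  funext a
  have hq : ∀ k, q (volterraSection w) k = 0 := fun k => by simp [q, coord, volterraSection]
  have hp : p (volterraSection w) (a + 1) = Real.log (w a) := coord_succ _ a
  rw [volterraMap_apply, linkForm_apply, hq, hq, hp, sub_zero, mul_zero, add_zero,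
    Real.exp_log (hw a)]

/-- The Volterra map is onto the orthant, so identities there need only be checked at image points.
-/
theorem forall_orthant {P : (Fin N → ℝ) → Prop} (h : ∀ x, P (volterraMap N x)) :
    ∀ w ∈ orthant N, P w := fun w hw => by
  rw [← volterraMap_section hw]; exact h _

theorem isOpen_orthant : IsOpen (orthant N) := by
  have h : orthant N = Set.univ.pi fun _ => Set.Ioi 0 := by ext w; simp [orthant]
  rw [h]
  exact isOpen_set_pi Set.finite_univ fun _ _ => isOpen_Ioi

theorem contDiffOn_volterraSection : ContDiffOn ℝ ∞ (volterraSection (N := N)) (orthant N) := by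
  refine contDiffOn_pi.2 fun c => ?_
  rcases c with i | i
  · exact contDiffOn_const
  · exact (contDiff_apply ℝ ℝ i).contDiffOn.log fun w hw => (hw i).ne'

theorem ContDiffOn.differentiableAt_volterraMap {F : Type*} [NormedAddCommGroup F]
    [NormedSpace ℝ F] {f : (Fin N → ℝ) → F} (hf : ContDiffOn ℝ ∞ f (orthant N)) (x : Phase N) :
    DifferentiableAt ℝ f (volterraMap N x) :=
  (hf.contDiffAt (isOpen_orthant.mem_nhds (volterraMap_mem x))).differentiableAt (by simp)

/-- A function on the orthant whose pullback is smooth is smooth. -/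
theorem contDiffOn_of_pullback {F : Type*} [NormedAddCommGroup F] [NormedSpace ℝ F]
    {f : (Fin N → ℝ) → F} {g : Phase N → F} (hg : ContDiff ℝ ∞ g)
    (h : ∀ x, g x = f (volterraMap N x)) : ContDiffOn ℝ ∞ f (orthant N) := by
  refine (hg.comp_contDiffOn contDiffOn_volterraSection).congr fun w hw => ?_
  rw [Function.comp_apply, h, volterraMap_section hw]

/-- The projection of the master symmetry `X_i`. -/
noncomputable def projX (N i : ℕ) (w : Fin N → ℝ) : Fin N → ℝ :=
  fderiv ℝ (volterraMap N) (volterraSection w) (X N i (volterraSection w))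

/-- The projection of the tensor `J_j`. -/
noncomputable def projJ (N j : ℕ) (w : Fin N → ℝ) : Matrix (Fin N) (Fin N) ℝ :=
  Matrix.of fun a b => bracket (J N j) (fun y => volterraMap N y a) (fun y => volterraMap N y b)
    (volterraSection w)

/-- `J₃` sees x only through u, and `J₂` is constant. Together with the same property of the
differential of the Volterra map, this makes X_i and J_j constant along fibres in the sense needed
to descend. -/
theorem R_congr {x y : Phase N} (h : volterraMap N x = volterraMap N y) : R N x = R N y := by
  have h3 : J₃ N x = J₃ N y := by
    ext a c
    simp only [J₃_apply, u, h]
  rw [R, R, h3]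
  rfl

theorem fderiv_volterraMap_congr {x y : Phase N} (h : volterraMap N x = volterraMap N y) :
    fderiv ℝ (volterraMap N) x = fderiv ℝ (volterraMap N) y := by
  ext v a
  rw [fderiv_volterraMap, fderiv_volterraMap, h]

theorem fderiv_volterraMap_comp_apply (x v : Phase N) (a : Fin N) :
    fderiv ℝ (fun y => volterraMap N y a) x v = fderiv ℝ (volterraMap N) x v a := by
  rw [fderiv_apply (hasFDerivAt_volterraMap x).differentiableAt]
  rfl

theorem fderiv_volterraMap_X (i : ℕ) (x : Phase N) :
    fderiv ℝ (volterraMap N) x (X N i x) = projX N i (volterraMap N x) := by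
  have h := volterraMap_section (volterraMap_mem x)
  rw [projX, fderiv_volterraMap_congr h, X, X, R_congr h]
  rfl

theorem bracket_volterraMap (j : ℕ) (x : Phase N) (a b : Fin N) :
    bracket (J N j) (fun y => volterraMap N y a) (fun y => volterraMap N y b) x
      = projJ N j (volterraMap N x) a b := by
  have h := volterraMap_section (volterraMap_mem x)
  have hg : ∀ a, grad (fun y => volterraMap N y a) x
      = grad (fun y => volterraMap N y a) (volterraSection (volterraMap N x)) := by
    intro a
    funext c
    rw [grad, grad, fderiv_volterraMap_comp_apply, fderiv_volterraMap_comp_apply,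
      fderiv_volterraMap_congr h]
  rw [projJ, Matrix.of_apply, bracket, bracket, hg, hg, J, J, R_congr h]
  rfl

theorem contDiffOn_projX (i : ℕ) : ContDiffOn ℝ ∞ (projX N i) (orthant N) :=
  contDiffOn_of_pullback ((contDiff_volterraMap.fderiv_right (by simp)).clm_apply (contDiff_X i))
    (fderiv_volterraMap_X i)

theorem contDiff_volterraMap_apply (a : Fin N) : ContDiff ℝ ∞ (fun y => volterraMap N y a) :=
  contDiff_pi.1 contDiff_volterraMap a

theorem contDiff_bracket_J (j : ℕ) {f g : Phase N → ℝ} (hf : ContDiff ℝ ∞ f)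
    (hg : ContDiff ℝ ∞ g) : ContDiff ℝ ∞ (bracket (J N j) f g) :=
  contDiff_bracket (J_mulVec j) (contDiff_tensorOp _) hf hg

theorem fderiv_comp_volterraMap {f : (Fin N → ℝ) → ℝ} {x : Phase N}
    (hf : DifferentiableAt ℝ f (volterraMap N x)) (v : Phase N) :
    fderiv ℝ (fun y => f (volterraMap N y)) x v
      = fderiv ℝ f (volterraMap N x) (fderiv ℝ (volterraMap N) x v) := by
  have h := hf.hasFDerivAt.comp x (hasFDerivAt_volterraMap x).differentiableAt.hasFDerivAt
  exact congr($(h.fderiv) v)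

theorem grad_comp_volterraMap {f : (Fin N → ℝ) → ℝ} {x : Phase N}
    (hf : DifferentiableAt ℝ f (volterraMap N x)) (c : Fin N ⊕ Fin N) :
    grad (fun y => f (volterraMap N y)) x c
      = ∑ a, grad f (volterraMap N x) a * grad (fun y => volterraMap N y a) x c := by
  rw [grad, fderiv_comp_volterraMap hf, fderiv_eq_grad_dotProduct]
  simp only [dotProduct, grad, fderiv_volterraMap_comp_apply]

/-- The Volterra map is Poisson from `J_j` to its projection. -/
theorem bracket_comp_volterraMap (j : ℕ) {f g : (Fin N → ℝ) → ℝ} {x : Phase N}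
    (hf : DifferentiableAt ℝ f (volterraMap N x)) (hg : DifferentiableAt ℝ g (volterraMap N x)) :
    bracket (J N j) (fun y => f (volterraMap N y)) (fun y => g (volterraMap N y)) x
      = bracket (projJ N j) f g (volterraMap N x) := by
  set D : Matrix (Fin N) (Fin N ⊕ Fin N) ℝ :=
    Matrix.of fun a c => grad (fun y => volterraMap N y a) x c with hD
  have h1 : ∀ {f : (Fin N → ℝ) → ℝ}, DifferentiableAt ℝ f (volterraMap N x) →
      grad (fun y => f (volterraMap N y)) x = D.transpose.mulVec (grad f (volterraMap N x)) := by
    intro f hf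
    funext c
    rw [grad_comp_volterraMap hf]
    exact Finset.sum_congr rfl fun a _ => mul_comm _ _
  have h2 : projJ N j (volterraMap N x) = D * J N j x * D.transpose := by
    ext a b
    rw [← bracket_volterraMap, bracket_eq_dotProduct, Matrix.mul_assoc, Matrix.mul_apply]
    refine Finset.sum_congr rfl fun c _ => ?_
    rfl
  rw [bracket_eq_dotProduct, bracket_eq_dotProduct, h1 hf, h1 hg, h2, Matrix.mulVec_transpose D,
    ← Matrix.dotProduct_mulVec, Matrix.mulVec_mulVec, Matrix.mulVec_mulVec, Matrix.mul_assoc]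

theorem contDiff_comp_volterraMap {f : (Fin N → ℝ) → ℝ} (hf : ContDiffOn ℝ ∞ f (orthant N)) :
    ContDiff ℝ ∞ (fun y => f (volterraMap N y)) :=
  hf.comp_contDiff contDiff_volterraMap volterraMap_mem

theorem contDiffOn_bracket_projJ (j : ℕ) {f g : (Fin N → ℝ) → ℝ}
    (hf : ContDiffOn ℝ ∞ f (orthant N)) (hg : ContDiffOn ℝ ∞ g (orthant N)) :
    ContDiffOn ℝ ∞ (bracket (projJ N j) f g) (orthant N) :=
  contDiffOn_of_pullback
    (contDiff_bracket_J j (contDiff_comp_volterraMap hf) (contDiff_comp_volterraMap hg))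
    fun x => bracket_comp_volterraMap j (ContDiffOn.differentiableAt_volterraMap hf x)
      (ContDiffOn.differentiableAt_volterraMap hg x)

/-- Nested brackets downstairs pull back to nested brackets upstairs, so the Jacobi identity is
inherited through surjectivity. -/
theorem isPoissonOn_projJ (j : ℕ) : IsPoissonOn (orthant N) (projJ N j) := by
  refine ⟨fun a b => ?_, ?_, fun f g k hf hg hk => ?_⟩
  · exact contDiffOn_of_pullback (contDiff_bracket_J j (contDiff_volterraMap_apply a)
      (contDiff_volterraMap_apply b)) fun x => bracket_volterraMap j x a b
  · refine forall_orthant fun x a b => ?_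
    rw [← bracket_volterraMap, ← bracket_volterraMap, bracket_eq_dotProduct,
      bracket_eq_dotProduct, J_mulVec, J_mulVec, dotProduct_tensorOp_skew]
  · refine forall_orthant fun x => ?_
    have hd : ∀ {f : (Fin N → ℝ) → ℝ}, ContDiffOn ℝ ∞ f (orthant N) → ∀ x,
        DifferentiableAt ℝ f (volterraMap N x) := fun hf x =>
      ContDiffOn.differentiableAt_volterraMap hf x
    have h : ∀ {f g k : (Fin N → ℝ) → ℝ}, ContDiffOn ℝ ∞ f (orthant N) →
        ContDiffOn ℝ ∞ g (orthant N) → ContDiffOn ℝ ∞ k (orthant N) →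
        bracket (projJ N j) f (bracket (projJ N j) g k) (volterraMap N x)
          = bracket (J N j) (fun y => f (volterraMap N y)) (bracket (J N j)
            (fun y => g (volterraMap N y)) (fun y => k (volterraMap N y))) x := by
      intro f g k hf hg hk
      rw [← bracket_comp_volterraMap j (hd hf x) (hd (contDiffOn_bracket_projJ j hg hk) x)]
      congr 1
      funext y
      rw [bracket_comp_volterraMap j (hd hg y) (hd hk y)]
    rw [h hf hg hk, h hg hk hf, h hk hf hg]
    exact (isPoissonOn_J j).2.2 _ _ _ (contDiff_comp_volterraMap hf).contDiffOn
      (contDiff_comp_volterraMap hg).contDiffOn (contDiff_comp_volterraMap hk).contDiffOn x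
      (Set.mem_univ x)

theorem deriv_projX (i : ℕ) {f : (Fin N → ℝ) → ℝ} {x : Phase N}
    (hf : DifferentiableAt ℝ f (volterraMap N x)) :
    deriv (projX N i) f (volterraMap N x) = deriv (X N i) (fun y => f (volterraMap N y)) x := by
  rw [deriv, deriv, fderiv_comp_volterraMap hf, fderiv_volterraMap_X]

theorem lieDeriv_projJ (i : ℕ) {j : ℕ} (hj : 2 ≤ j) (x : Phase N) :
    lieDeriv (projX N i) (projJ N j) (volterraMap N x)
      = ((j : ℝ) - i - 2) • projJ N (i + j) (volterraMap N x) := by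
  ext a b
  have hc : ∀ a : Fin N, ContDiffOn ℝ ∞ (fun w : Fin N → ℝ => w a) (orthant N) := fun a =>
    (contDiff_apply ℝ ℝ a).contDiffOn
  have hY : ∀ a : Fin N, ContDiffOn ℝ ∞ (fun w : Fin N → ℝ => projX N i w a) (orthant N) :=
    fun a => contDiffOn_pi.1 (contDiffOn_projX i) a
  have hd : ∀ {f : (Fin N → ℝ) → ℝ}, ContDiffOn ℝ ∞ f (orthant N) → ∀ x,
      DifferentiableAt ℝ f (volterraMap N x) := fun hf x =>
    ContDiffOn.differentiableAt_volterraMap hf x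
  have hXY : ∀ a, (fun y => projX N i (volterraMap N y) a)
      = deriv (X N i) (fun y => volterraMap N y a) := by
    intro a
    funext y
    rw [deriv, fderiv_volterraMap_comp_apply, fderiv_volterraMap_X]
  have hb : (fun y => bracket (projJ N j) (fun w => w a) (fun w => w b) (volterraMap N y))
      = bracket (J N j) (fun y => volterraMap N y a) (fun y => volterraMap N y b) := by
    funext y
    rw [← bracket_comp_volterraMap j (hd (hc a) y) (hd (hc b) y)]
  rw [lieDeriv_eq_bracket, deriv_projX i (hd (contDiffOn_bracket_projJ j (hc a) (hc b)) x), hb,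
    ← bracket_comp_volterraMap j (hd (hY a) x) (hd (hc b) x),
    ← bracket_comp_volterraMap j (hd (hc a) x) (hd (hY b) x), hXY, hXY,
    deriv_bracket_J i hj (contDiff_volterraMap_apply a) (contDiff_volterraMap_apply b),
    bracket_volterraMap, Matrix.smul_apply, smul_eq_mul]

theorem lieBracket_projX (i j : ℕ) (x : Phase N) :
    VectorField.lieBracket ℝ (projX N i) (projX N j) (volterraMap N x)
      = ((j : ℝ) - i) • projX N (i + j) (volterraMap N x) := by
  rw [lieBracket_related contDiff_volterraMap ((contDiff_X i).differentiable (by simp))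
    ((contDiff_X j).differentiable (by simp))
    (ContDiffOn.differentiableAt_volterraMap (contDiffOn_projX i) x)
    (ContDiffOn.differentiableAt_volterraMap (contDiffOn_projX j) x)
    (fderiv_volterraMap_X i) (fderiv_volterraMap_X j), lieBracket_X, map_smul,
    fderiv_volterraMap_X]

/-! ### The projected Hamiltonians and flows -/

theorem H_volterraMap (j : ℕ) : (fun x => H j (volterraMap N x)) = fun x => 2 * ham N j x := by
  funext x
  rw [ham]; ring

theorem grad_H_volterraMap (j : ℕ) (x : Phase N) :
    grad (fun x => H j (volterraMap N x)) x = (2 : ℝ) • grad (ham N j) x := by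
  rw [H_volterraMap, grad_const_mul _ ((contDiff_ham j).differentiable (by simp) x)]

theorem differentiableAt_H (j : ℕ) (x : Phase N) : DifferentiableAt ℝ (H j) (volterraMap N x) :=
  ContDiffOn.differentiableAt_volterraMap (contDiffOn_H j) x

theorem bracket_projJ_H {i k : ℕ} (j : ℕ) (hi : 1 ≤ i) (hk : 1 ≤ k) (x : Phase N) :
    bracket (projJ N j) (H i) (H k) (volterraMap N x) = 0 := by
  have h := isLenardSequence_ham.bracket_eq_zero j hi hk x
  rw [bracket_eq_dotProduct] at h
  rw [← bracket_comp_volterraMap j (differentiableAt_H i x) (differentiableAt_H k x),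
    bracket_eq_dotProduct, grad_H_volterraMap, grad_H_volterraMap, Matrix.mulVec_smul,
    smul_dotProduct, dotProduct_smul, h, smul_zero, smul_zero]

theorem deriv_projX_H (i : ℕ) {j : ℕ} (hj : 1 ≤ j) (x : Phase N) :
    deriv (projX N i) (H j) (volterraMap N x) = ((i : ℝ) + j) * H (i + j) (volterraMap N x) := by
  have h := isLenardSequence_ham.deriv_X_apply i hj x
  rw [deriv, fderiv_eq_grad_dotProduct] at h
  rw [deriv_projX i (differentiableAt_H j x), deriv, fderiv_eq_grad_dotProduct,
    grad_H_volterraMap, smul_dotProduct, h, ham, smul_eq_mul]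
  ring

/-- For j ≥ 2 the result depends on i and j only through i + j, which is the Lenard relation between
the π_j. -/
theorem projJ_mulVec_grad_H (j : ℕ) {i : ℕ} (hi : 1 ≤ i) (x : Phase N) :
    (projJ N j (volterraMap N x)).mulVec (grad (H i) (volterraMap N x))
      = fderiv ℝ (volterraMap N) x ((2 : ℝ) • flow N (j - 2 + i) x) := by
  funext a
  have h1 : (projJ N j (volterraMap N x)).mulVec (grad (H i) (volterraMap N x)) a
      = bracket (projJ N j) (fun w => w a) (H i) (volterraMap N x) := by
    rw [bracket_eq_dotProduct, grad_proj, single_one_dotProduct]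
  rw [h1, ← bracket_comp_volterraMap j (differentiableAt_apply a _) (differentiableAt_H i x),
    bracket_eq_fderiv, J_mulVec, grad_H_volterraMap, tensorOp_apply, map_smul, map_smul,
    isLenardSequence_ham.recOp_pow_canonOp_grad _ hi, fderiv_volterraMap_comp_apply]

/-! ### Explicit formulas -/

/-- Hence the Hamiltonian vector of log u_{a+1} for J₂ is b_{a+1} - b_a, and projected brackets
reduce to pairings of chain vectors. -/
theorem canonOp_sympl (x : Phase N) : canonOp N (fun c => sympl N x (Pi.single c 1)) = -x := by
  rw [← J₂_mulVec_eq 0, J₂_mulVec]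
  funext c
  rcases c with i | i
  · simp [sympl_apply, Pi.single_apply]
  · simp [sympl_apply, Pi.single_apply]

theorem grad_volterraMap (x : Phase N) (a : Fin N) :
    grad (fun y => volterraMap N y a) x
      = volterraMap N x a • fun c => sympl N (chainVec N a - chainVec N (a + 1)) (Pi.single c 1) := by
  funext c
  rw [grad, fderiv_volterraMap_comp_apply, fderiv_volterraMap, linkForm, map_sub]
  rfl

theorem projJ_volterraMap (j : ℕ) (x : Phase N) (a b : Fin N) :
    projJ N j (volterraMap N x) a b = volterraMap N x a * volterraMap N x b *
      linkForm N a ((recOp N x ^ (j - 2)) (chainVec N (b + 1) - chainVec N b)) := by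
  rw [← bracket_volterraMap, bracket_eq_fderiv, J_mulVec, grad_volterraMap, tensorOp_apply,
    map_smul, canonOp_sympl, neg_sub, map_smul, map_smul, fderiv_volterraMap_comp_apply,
    fderiv_volterraMap, smul_eq_mul]
  ring

theorem projX_zero (x : Phase N) : projX N 0 (volterraMap N x) = Y₀ (volterraMap N x) := by
  rw [← fderiv_volterraMap_X]
  funext a
  rw [fderiv_volterraMap, linkForm, sub_apply]
  have : X N 0 x = X₀ N x := by rw [X_eq]; rfl
  rw [this, sympl_X₀ a.2, mul_one, Y₀]

/-- Unit steps starting from 0. These values produce the explicit index i in the coefficients of Y₁.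
-/
theorem sympl_chainVec_X₀ {k : ℕ} (hk : k ≤ N) (x : Phase N) :
    sympl N (chainVec N k) (X₀ N x) = -(k : ℝ) := by
  induction k with
  | zero =>
    rw [sympl_chainVec]
    simp [chainQ, q, coord, X₀]
  | succ k ih =>
    have h1 := sympl_X₀ hk x
    rw [ih (by omega)] at h1
    push_cast
    linarith

theorem linkForm_recOp {a : ℕ} (ha : a < N) (x v : Phase N) :
    linkForm N a (recOp N x v) = ∑ k ∈ Finset.range N, u x (k + 1) *
      (sympl N (chainVec N k) v * ((if k + 1 = a then 1 else 0) + (if k = a then 1 else 0))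
        - sympl N (chainVec N (k + 1)) v * ((if k = a then 1 else 0)
          + (if k = a + 1 then 1 else 0))) := by
  rw [recOp, Nijenhuis.chainOp_apply, map_sum]
  refine Finset.sum_congr rfl fun k hk => ?_
  have hk := Finset.mem_range.1 hk
  rw [← u_succ_eq_exp hk, map_smul, Nijenhuis.chainTerm_apply, map_sub, map_smul, map_smul,
    linkForm_chainVec ha hk.le, linkForm_chainVec ha (by omega : k + 1 ≤ N)]
  simp only [smul_eq_mul, add_left_inj]
  ring

theorem projX_one (x : Phase N) : projX N 1 (volterraMap N x) = Y₁ (volterraMap N x) := by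
  rw [← fderiv_volterraMap_X]
  funext a
  have h1 : X N 1 x = recOp N x (X₀ N x) := by rw [X_eq, pow_one]
  have h2 : linkForm N a (recOp N x (X₀ N x))
      = u x (a + 1) + ((a : ℝ) + 2) * u x (a + 2) - ((a : ℝ) - 1) * u x a := by
    rw [linkForm_recOp a.2, ← sum_range_mul_ite x (a + 1), ← sum_range_mul_ite x (a + 2),
      ← sum_range_mul_ite x a, Finset.mul_sum, Finset.mul_sum, ← Finset.sum_add_distrib,
      ← Finset.sum_sub_distrib]
    refine Finset.sum_congr rfl fun k hk => ?_
    have hk := Finset.mem_range.1 hk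
    rw [sympl_chainVec_X₀ hk.le, sympl_chainVec_X₀ hk]
    generalize (a : ℕ) = m
    push_cast
    -- Only link `m` and its two neighbours meet link `m`, giving the terms in u_{i-1}, u_i and
    -- u_{i+1} with i = m + 1.
    by_cases e1 : k + 1 = m
    · have e : (m : ℝ) = k + 1 := by exact_mod_cast e1.symm
      simp only [if_pos e1, if_neg (show ¬k = m by omega), if_neg (show ¬k = m + 1 by omega), e]
      ring
    by_cases e2 : k = m
    · simp only [if_neg e1, if_pos e2, if_neg (show ¬k = m + 1 by omega)]
      ring
    by_cases e3 : k = m + 1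
    · have e : (k : ℝ) = m + 1 := by exact_mod_cast e3
      simp only [if_neg e1, if_neg e2, if_pos e3, e]
      ring
    · simp only [if_neg e1, if_neg e2, if_neg e3]
      ring
  rw [fderiv_volterraMap, h1, h2]
  simp only [Y₁, u, coord_succ, Nat.add_sub_cancel]
  push_cast
  ring

theorem projJ_two (x : Phase N) : projJ N 2 (volterraMap N x) = π₂ (volterraMap N x) := by
  ext a b
  have h : linkForm N a (chainVec N (b + 1) - chainVec N b)
      = (if (b : ℕ) = a + 1 then 1 else 0) - (if (a : ℕ) = b + 1 then 1 else 0) := by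
    rw [map_sub, linkForm_chainVec a.2 b.2, linkForm_chainVec a.2 b.2.le]
    grind
  rw [projJ_volterraMap]
  simp only [Nat.sub_self, pow_zero, one_apply_eq_self, h, π₂, Matrix.of_apply]
  grind

theorem projJ_three (x : Phase N) : projJ N 3 (volterraMap N x) = π₃ (volterraMap N x) := by
  ext a b
  have h : linkForm N a (recOp N x (chainVec N (b + 1) - chainVec N b))
      = (if (b : ℕ) = a + 1 then 1 else 0) * (u x (a + 1) + u x (a + 2))
        + (if (b : ℕ) = a + 2 then 1 else 0) * u x (a + 2)
        - (if (a : ℕ) = b + 1 then 1 else 0) * (u x (b + 1) + u x (b + 2))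
        - (if (a : ℕ) = b + 2 then 1 else 0) * u x (b + 2) := by
    rw [linkForm_recOp a.2]
    rw [← sum_range_mul_ite x (a + 1), ← sum_range_mul_ite x (a + 2),
      ← sum_range_mul_ite x (b + 1), ← sum_range_mul_ite x (b + 2)]
    simp only [Finset.mul_sum, ← Finset.sum_add_distrib, ← Finset.sum_sub_distrib]
    refine Finset.sum_congr rfl fun k hk => ?_
    have hk := Finset.mem_range.1 hk
    have e : ∀ m, m ≤ N → sympl N (chainVec N m) (chainVec N (b + 1) - chainVec N b)
        = -((if m = b then 1 else 0) + (if m = (b : ℕ) + 1 then 1 else 0)) := by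
      intro m hm
      rw [← linkForm_chainVec b.2 hm, sympl_skew, linkForm, map_sub]
      simp
    rw [e k hk.le, e (k + 1) (by omega)]
    generalize (a : ℕ) = a, (b : ℕ) = b
    simp only [add_left_inj]
    grind (splits := 14)
  rw [projJ_volterraMap]
  have h1 : ∀ a : Fin N, u x (a + 1) = volterraMap N x a := fun a => coord_succ _ a
  have hu : ∀ k, coord (volterraMap N x) k = u x k := fun _ => rfl
  simp only [Nat.reduceSub, pow_one, h, h1, π₃, Matrix.of_apply, hu]
  have h2 : (b : ℕ) = a + 1 → u x (a + 2) = volterraMap N x b := by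
    intro hb
    rw [← h1, hb]
  have h3 : (a : ℕ) = b + 1 → u x (b + 2) = volterraMap N x a := by
    intro hb
    rw [← h1, hb]
  grind

/-! ### Master symmetries of the KM-system -/

/-- The flow `π₂ ∇H_j` of the KM hierarchy. -/
noncomputable def kmFlow (j : ℕ) (w : Fin N → ℝ) : Fin N → ℝ := (π₂ w).mulVec (grad (H j) w)

theorem fderiv_volterraMap_flow {j : ℕ} (hj : 1 ≤ j) (x : Phase N) :
    fderiv ℝ (volterraMap N) x (((2 : ℝ) • flow N j) x) = kmFlow j (volterraMap N x) := by
  have h := projJ_mulVec_grad_H 2 hj x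
  rw [Nat.sub_self, zero_add] at h
  rw [kmFlow, ← projJ_two, h]
  rfl

theorem contDiff_two_smul_flow {j : ℕ} (hj : 1 ≤ j) : ContDiff ℝ ∞ ((2 : ℝ) • flow N j) :=
  contDiff_const.smul (isLenardSequence_ham.contDiff_flow hj)

theorem contDiffOn_kmFlow {j : ℕ} (hj : 1 ≤ j) :
    ContDiffOn ℝ ∞ (kmFlow (N := N) j) (orthant N) :=
  contDiffOn_of_pullback ((contDiff_volterraMap.fderiv_right (by simp)).clm_apply
    (contDiff_two_smul_flow hj)) (fderiv_volterraMap_flow hj)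

theorem lieBracket_projX_kmFlow (i : ℕ) {j : ℕ} (hj : 1 ≤ j) (x : Phase N) :
    VectorField.lieBracket ℝ (projX N i) (kmFlow j) (volterraMap N x)
      = (j : ℝ) • kmFlow (i + j) (volterraMap N x) := by
  rw [lieBracket_related contDiff_volterraMap ((contDiff_X i).differentiable (by simp))
    ((contDiff_two_smul_flow hj).differentiable (by simp))
    (ContDiffOn.differentiableAt_volterraMap (contDiffOn_projX i) x)
    (ContDiffOn.differentiableAt_volterraMap (contDiffOn_kmFlow hj) x)
    (fderiv_volterraMap_X i) (fderiv_volterraMap_flow hj),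
    VectorField.lieBracket_const_smul_right
      ((isLenardSequence_ham.contDiff_flow hj).differentiable (by simp) x),
    isLenardSequence_ham.lieBracket_X_flow i hj, ← fderiv_volterraMap_flow (by omega),
    smul_comm, map_smul]
  rfl

theorem lieBracket_kmFlow {i j : ℕ} (hi : 1 ≤ i) (hj : 1 ≤ j) (x : Phase N) :
    VectorField.lieBracket ℝ (kmFlow i) (kmFlow j) (volterraMap N x) = 0 := by
  rw [lieBracket_related contDiff_volterraMap
    ((contDiff_two_smul_flow hi).differentiable (by simp))
    ((contDiff_two_smul_flow hj).differentiable (by simp))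
    (ContDiffOn.differentiableAt_volterraMap (contDiffOn_kmFlow hi) x)
    (ContDiffOn.differentiableAt_volterraMap (contDiffOn_kmFlow hj) x)
    (fderiv_volterraMap_flow hi) (fderiv_volterraMap_flow hj),
    VectorField.lieBracket_const_smul_right
      ((isLenardSequence_ham.contDiff_flow hj).differentiable (by simp) x),
    VectorField.lieBracket_const_smul_left
      ((isLenardSequence_ham.contDiff_flow hi).differentiable (by simp) x),
    isLenardSequence_ham.lieBracket_flow hi hj, smul_zero, smul_zero, map_zero]

/-! ### Nonvanishing of the KM flows -/

theorem grad_H_one_pos (hN : 2 ≤ N) {j : ℕ} (hj : 1 ≤ j) (x : Phase N) :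
    0 < grad (H j) (volterraMap N x) ⟨1, hN⟩ := by
  -- The direction ∂/∂p_2 moves log u_2 and no other log u_k, so it isolates the partial derivative
  -- with respect to u_2.
  set e : Phase N := Pi.single (Sum.inr ⟨1, hN⟩) 1 with he
  have hq : ∀ k, q e k = 0 := by
    intro k
    simp [q, he, coord]
  have hp : ∀ k, k < N → p e (k + 1) = if k = 1 then 1 else 0 := by
    intro k hk
    rw [p, coord_of_lt hk]
    simp [he, Pi.single_apply]
  have h1 : ∀ k, k < N → linkForm N k e = if k = 1 then 1 else 0 := by
    intro k hk
    rw [linkForm_apply, hq, hq, hp k hk]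
    ring
  have h2 : fderiv ℝ (volterraMap N) x e
      = volterraMap N x ⟨1, hN⟩ • Pi.single (⟨1, hN⟩ : Fin N) (1 : ℝ) := by
    funext a
    rw [fderiv_volterraMap, h1 a a.2]
    by_cases h : a = ⟨1, hN⟩
    · subst h; simp
    · have : (a : ℕ) ≠ 1 := fun h' => h (Fin.ext h')
      simp [h, this]
  have h3 : fderiv ℝ (ham N j) x e
      = sqrtCoord (volterraMap N x) 2 * ent (sqrtLax x ^ (2 * j - 1)) 1 2 := by
    rw [fderiv_ham hj, Finset.sum_eq_single 1]
    · rw [h1 1 hN, if_pos rfl, one_mul]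
    · intro k hk hk1
      rw [h1 k (Finset.mem_range.1 hk), if_neg hk1, zero_mul]
    · intro h
      exact absurd (Finset.mem_range.2 hN) h
  have h4 : 0 < fderiv ℝ (ham N j) x e := by
    rw [h3]
    refine mul_pos (Real.sqrt_pos.2 (coord_pos (volterraMap_mem x) (by omega) hN)) ?_
    obtain ⟨m, rfl⟩ := Nat.exists_eq_add_of_le' hj
    exact ent_sqrt_lax_pos hN (volterraMap_mem x) m
  have h5 : fderiv ℝ (fun y => H j (volterraMap N y)) x e = 2 * fderiv ℝ (ham N j) x e := by
    rw [fderiv_eq_grad_dotProduct, grad_H_volterraMap, smul_dotProduct,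
      ← fderiv_eq_grad_dotProduct, smul_eq_mul]
  rw [fderiv_comp_volterraMap (differentiableAt_H j x), h2, map_smul, smul_eq_mul] at h5
  have h6 : 0 < volterraMap N x ⟨1, hN⟩ := volterraMap_mem x _
  refine pos_of_mul_pos_right (a := volterraMap N x ⟨1, hN⟩) ?_ h6.le
  rw [grad, h5]
  linarith

/-- The first component of the flow is u_1 u_2 ∂H_j/∂u_2 > 0. For N = 1 the tensor `π₂` is zero,
hence the restriction on N. -/
theorem kmFlow_ne_zero (hN : 2 ≤ N) {j : ℕ} (hj : 1 ≤ j) (x : Phase N) :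
    kmFlow j (volterraMap N x) ≠ 0 := by
  have h1 := grad_H_one_pos hN hj x
  have h2 : kmFlow j (volterraMap N x) ⟨0, by omega⟩
      = volterraMap N x ⟨0, by omega⟩ * volterraMap N x ⟨1, hN⟩
        * grad (H j) (volterraMap N x) ⟨1, hN⟩ := by
    rw [kmFlow, Matrix.mulVec, dotProduct, Finset.sum_eq_single ⟨1, hN⟩]
    · simp [π₂]
    · intro b _ hb
      have : (b : ℕ) ≠ 1 := fun h => hb (Fin.ext h)
      simp [π₂, this]
    · simp
  intro h
  rw [h, Pi.zero_apply] at h2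
  exact (mul_pos (mul_pos (volterraMap_mem x _) (volterraMap_mem x _)) h1).ne h2

theorem isMasterSymmetryOn_projX (hN : 2 ≤ N) (i : ℕ) {j : ℕ} (hj : 1 ≤ j) :
    IsMasterSymmetryOn (orthant N) (projX N i) (kmFlow j) := by
  refine ⟨forall_orthant fun x => ?_, volterraMap N 0, volterraMap_mem 0, ?_⟩
  -- The inner bracket is known only on the orthant; openness gives equality near the point, which
  -- is all that the outer bracket sees.
  · have h : VectorField.lieBracket ℝ (projX N i) (kmFlow j)
        =ᶠ[nhds (volterraMap N x)] (j : ℝ) • kmFlow (i + j) :=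
      Filter.eventuallyEq_of_mem (isOpen_orthant.mem_nhds (volterraMap_mem x))
        (forall_orthant (lieBracket_projX_kmFlow i hj))
    rw [h.lieBracket_vectorField_eq Filter.EventuallyEq.rfl,
      VectorField.lieBracket_const_smul_left
        (ContDiffOn.differentiableAt_volterraMap (contDiffOn_kmFlow (by omega)) x),
      lieBracket_kmFlow (by omega) hj, smul_zero]
  · rw [lieBracket_projX_kmFlow i hj]
    exact smul_ne_zero (by positivity) (kmFlow_ne_zero hN (by omega) 0)

end KM

/-! ### Assembly of the hierarchy and its projection -/

theorem mainTheorem3 (n N : ℕ) (hn : 1 ≤ n) (hN : N = 2 * n - 1) :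
    -- conformal symmetry, with constants 0, 1, 1
    (∀ x, KM.lieDeriv (KM.X₀ N) (KM.J₂ N) x = 0) ∧
    (∀ x, KM.lieDeriv (KM.X₀ N) (KM.J₃ N) x = KM.J₃ N x) ∧
    (∀ x, KM.deriv (KM.X₀ N) (KM.h₁ N) x = KM.h₁ N x) ∧
    -- the tensors and vector fields generated by the recursion operator
    (∀ j, 2 ≤ j → KM.IsPoissonOn Set.univ (KM.J N j)) ∧
    (∀ i, ContDiff ℝ ∞ (KM.X N i)) ∧
    -- the Hamiltonians
    ∃ h : ℕ → KM.Phase N → ℝ,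
      (∀ j, 1 ≤ j → ContDiff ℝ ∞ (h j)) ∧
      h 1 = KM.h₁ N ∧
      (∀ j, 1 ≤ j → ∀ x,
        KM.grad (h j) x = ((KM.R N x).transpose ^ (j - 1)).mulVec (KM.grad (KM.h₁ N) x)) ∧
      (∀ j, 1 ≤ j → ∀ x, (KM.J₂ N x).mulVec (KM.grad (h j) x) = KM.flow N j x) ∧
      (∀ i j k, 1 ≤ i → 1 ≤ k → 2 ≤ j → ∀ x, KM.bracket (KM.J N j) (h i) (h k) x = 0) ∧
      (∀ i j, 1 ≤ i → 1 ≤ j → ∀ x,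
        VectorField.lieBracket ℝ (KM.flow N i) (KM.flow N j) x = 0) ∧
      -- master symmetries and deformation relations
      (∀ i j, 1 ≤ j → KM.IsMasterSymmetryOn Set.univ (KM.X N i) (KM.flow N j)) ∧
      (∀ i j, 1 ≤ j → ∀ x, KM.deriv (KM.X N i) (h j) x = ((i : ℝ) + j) * h (i + j) x) ∧
      (∀ i j, 2 ≤ j → ∀ x,
        KM.lieDeriv (KM.X N i) (KM.J N j) x = ((j : ℝ) - i - 2) • KM.J N (i + j) x) ∧
      (∀ i j, ∀ x,
        VectorField.lieBracket ℝ (KM.X N i) (KM.X N j) x = ((j : ℝ) - i) • KM.X N (i + j) x) ∧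
      -- projection through the Volterra map to the KM-system
      (∀ j, 1 ≤ j → ∀ x, KM.H j (KM.volterraMap N x) = 2 * h j x) ∧
      ∃ (Y : ℕ → (Fin N → ℝ) → Fin N → ℝ) (π : ℕ → (Fin N → ℝ) → Matrix (Fin N) (Fin N) ℝ),
        (∀ i x, fderiv ℝ (KM.volterraMap N) x (KM.X N i x) = Y i (KM.volterraMap N x)) ∧
        (∀ j, 2 ≤ j → ∀ x a b,
          KM.bracket (KM.J N j) (fun y => KM.volterraMap N y a) (fun y => KM.volterraMap N y b) x
            = π j (KM.volterraMap N x) a b) ∧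
        (∀ i, ContDiffOn ℝ ∞ (Y i) (KM.orthant N)) ∧
        (∀ w ∈ KM.orthant N,
          Y 0 w = KM.Y₀ w ∧ Y 1 w = KM.Y₁ w ∧ π 2 w = KM.π₂ w ∧ π 3 w = KM.π₃ w) ∧
        (2 ≤ n → ∀ i j, 1 ≤ j →
          KM.IsMasterSymmetryOn (KM.orthant N) (Y i)
            (fun w => (KM.π₂ w).mulVec (KM.grad (KM.H j) w))) ∧
        (∀ j, 2 ≤ j → KM.IsPoissonOn (KM.orthant N) (π j)) ∧
        (∀ i j k, 1 ≤ i → 1 ≤ k → 2 ≤ j → ∀ w ∈ KM.orthant N,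
          KM.bracket (π j) (KM.H i) (KM.H k) w = 0) ∧
        (∀ i j, 1 ≤ j → ∀ w ∈ KM.orthant N,
          KM.deriv (Y i) (KM.H j) w = ((i : ℝ) + j) * KM.H (i + j) w) ∧
        (∀ i j, 2 ≤ j → ∀ w ∈ KM.orthant N,
          KM.lieDeriv (Y i) (π j) w = ((j : ℝ) - i - 2) • π (i + j) w) ∧
        (∀ i j, ∀ w ∈ KM.orthant N,
          VectorField.lieBracket ℝ (Y i) (Y j) w = ((j : ℝ) - i) • Y (i + j) w) ∧
        (∀ i j, 1 ≤ i → 3 ≤ j → ∀ w ∈ KM.orthant N,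
          (π j w).mulVec (KM.grad (KM.H i) w) = (π (j - 1) w).mulVec (KM.grad (KM.H (i + 1)) w)) := by
  have hN1 : 1 ≤ N := by omega
  have hham := KM.isLenardSequence_ham (N := N)
  have hX0 : KM.X N 0 = KM.X₀ N := by funext x; simp [KM.X]
  have hJ3 : KM.J N 3 = KM.J₃ N := funext KM.J_three
  refine ⟨fun x => ?_, fun x => ?_, fun x => ?_, fun j _ => KM.isPoissonOn_J j, KM.contDiff_X,
    KM.ham N, fun j _ => KM.contDiff_ham j, hham.one, fun j hj => hham.grad_eq hj,
    fun j hj => hham.canonOp_grad hj, fun i j k hi hk _ => hham.bracket_eq_zero j hi hk,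
    fun i j hi hj => hham.lieBracket_flow hi hj,
    fun i j hj => hham.isMasterSymmetryOn i hj ⟨0, KM.flow_ne_zero hN1 (by omega) 0⟩,
    fun i j hj => hham.deriv_X_apply i hj, fun i j hj => KM.lieDeriv_J i hj, KM.lieBracket_X,
    fun j _ x => congrFun (KM.H_volterraMap j) x, KM.projX N, KM.projJ N,
    KM.fderiv_volterraMap_X, fun j _ => KM.bracket_volterraMap j, KM.contDiffOn_projX,
    KM.forall_orthant fun x => ⟨KM.projX_zero x, KM.projX_one x, KM.projJ_two x, KM.projJ_three x⟩,
    fun hn2 i j hj => KM.isMasterSymmetryOn_projX (by omega) i hj,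
    fun j _ => KM.isPoissonOn_projJ j,
    fun i j k hi hk _ => KM.forall_orthant (KM.bracket_projJ_H j hi hk),
    fun i j hj => KM.forall_orthant (KM.deriv_projX_H i hj),
    fun i j hj => KM.forall_orthant (KM.lieDeriv_projJ i hj),
    fun i j => KM.forall_orthant (KM.lieBracket_projX i j),
    fun i j hi hj => KM.forall_orthant fun x => ?_⟩
  -- The conformal relations are the case i = 0 of the deformation relation: weight 0 for j = 2 and
  -- weight 1 for j = 3.
  · have h := KM.lieDeriv_J (N := N) 0 le_rfl x
    rw [hX0, KM.J_two_eq] at h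
    rw [h]
    simp
  · have h := KM.lieDeriv_J (N := N) 0 (by norm_num : 2 ≤ 3) x
    rw [hX0, hJ3] at h
    rw [h]
    norm_num
  · have h := hham.euler 1 le_rfl x
    rwa [hham.one, Nat.cast_one, one_mul] at h
  -- Both sides are the image of 2 χ_{i+j-2}; j ≥ 3 keeps the truncated subtraction (j - 1) - 2
  -- exact.
  · rw [KM.projJ_mulVec_grad_H j hi, KM.projJ_mulVec_grad_H (j - 1) (by omega)]
    congr 3
    omega
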